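/- Let $J,K\in\mathbb{R}\cup\{\infty\}$ and let $$F^{(J,K)}_{udK}(x,u)=\bigl(u-\max\{x+u-J,0\}+\max\{x+u-K,0\},\;x-\max\{x+u-K,0\}+\max\{x+u-J,0\}\bigr),\qquad (x,u)\in\mathbb{R}^2,$$ where $\max\{s-\infty,0\}:=0$. Let $\mathcal{X}^*$ be the set of $x\in\mathbb{R}^{\mathbb{Z}}$ for which there is a unique $(x_n^t,u_n^t)_{n,t\in\mathbb{Z}}$ with $F^{(J,K)}_{udK}(x_n^t,u_{n-1}^t)=(x_n^{t+1},u_n^t)$ for all $n,t\in\mathbb{Z}$ and $x_n^0=x_n$ for all $n$. Let $\mathcal{X}^{\exists!}$ be the set of $x\in\mathbb{R}^{\mathbb{Z}}$ for which there is a unique $(u_n)_{n\in\mathbb{Z}}$ with $(F^{(J,K)}_{udK})^{(2)}(x_n,u_{n-1})=u_n$ for all $n$. On $\mathcal{X}^*$ put $U_n(x):=u_n^0$, and on $\mathcal{X}^{\exists!}$ put $U_n(x):=u_n$ (these agree on the intersection). The one-step dynamics is $\mathcal{T}^{(J,K)}_{udK}(x)_n:=(F^{(J,K)}_{udK})^{(1)}(x_n,U_{n-1}(x))$;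 on $\mathcal{X}^*$ this equals $x_n^1$. For $c_1<c_2\le\infty$ let $\mathrm{stExp}(\lambda,c_1,c_2)$ be the probability measure on $\mathbb{R}$ with density proportional to $e^{-\lambda x}\mathbf{1}\{c_1\le x\le c_2\}$ (with $\lambda>0$ if $c_2=\infty$). For $\theta,\kappa,m>0$, $M\in\mathbb{Z}$, $N\in\mathbb{Z}\cup\{\infty\}$ with $M\le N$ (and $\theta<1$ if $N=\infty$) let $\mathrm{sstbGeo}(1-\theta,M,N,\kappa,m)$ be the probability measure giving to $mx$, for integers $M\le x\le N$, mass proportional to $\theta^x$ if $x$ is even and to $\theta^x\kappa$ if $x$ is odd. Say that a probability measure $\mu$ on $\mathbb{R}$ satisfies (E) if it is one of the following: - $\mu=\mathrm{stExp}(\lambda,c,J-c)$, where $c\in\mathbb{R}$, $c<\min\{\frac J2,\frac K2\}$, and $\lambda\in\mathbb{R}$ if $\max\{J,K\}<\infty$, $\lambda>0$ if $\max\{J,K\}=\infty$; - $\mu=\mathrm{sstbGeo}(1-\theta,\frac cm,\frac{J-c}m,\kappa,m)$, where $c\in\mathbb{R}$, $c<\min\{\frac J2,\frac K2\}$, $m>0$,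 $c,J,K\in m\mathbb{Z}\cup\{\infty\}$, and either $J-2c,K-2c\in m\mathbb{Z}\cup\{\infty\}$, $\theta\in(0,1)$, $\kappa=1$; or $J-2c,K-2c\in 2m\mathbb{Z}\cup\{\infty\}$, $\theta\in(0,1)$, $\kappa\in(0,\infty)\setminus\{1\}$; or $J-2c,K-2c\in m\mathbb{Z}$, $\theta\ge1$, $\kappa=1$; or $J-2c,K-2c\in 2m\mathbb{Z}$, $\theta\ge1$, $\kappa\in(0,\infty)\setminus\{1\}$. **Theorem.** Let $\mu$ be a probability measure on $\mathbb{R}$, and let $\mu^{\mathbb{Z}}$ be the law of an i.i.d. sequence indexed by $\mathbb{Z}$ with marginal $\mu$. In each of the following cases, $\mu^{\mathbb{Z}}$-a.e. configuration lies in $\mathcal{X}^*$ (so $\mathcal{T}^{(J,K)}_{udK}$ is defined $\mu^{\mathbb{Z}}$-a.e.) and $\mathcal{T}^{(J,K)}_{udK}\mu^{\mathbb{Z}}=\mu^{\mathbb{Z}}$, i.e. $\mu^{\mathbb{Z}}$ is equal to its image under $\mathcal{T}^{(J,K)}_{udK}$. (a) $J=K$, and $\mu$ is arbitrary. (b) $J<K$,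 $\mu\neq\delta_{J/2}$, and $\mu$ satisfies (E), or $\mu$ is supported on $(-\infty,\frac J2]$, or $K<\infty$ and $\mu$ is supported on $[\frac J2,\infty)$. (c) $J>K$, $\mu\neq\delta_{K/2}$, $\mu\neq\delta_{J-K/2}$ (the latter if $J<\infty$), and $\mu$ satisfies (E), or $\mu$ is supported on $(-\infty,\frac K2]$, or $J<\infty$ and $\mu$ is supported on $[J-\frac K2,\infty)$. In this case, moreover, $\mu^{\mathbb{Z}}$-a.e. configuration lies in $\mathcal{X}^{\exists!}$. -/

import Mathlib

open MeasureTheory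

namespace UdKdV

noncomputable section

/-- The quantity `max {s - J, 0}` for a capacity `J` in `ℝ ∪ {∞}`; it is `0` when `J = ∞`. -/
def excess (J : WithTop ℝ) (s : ℝ) : ℝ :=
  WithTop.recTopCoe 0 (fun j : ℝ => max (s - j) 0) J

@[simp] theorem excess_top (s : ℝ) : excess ⊤ s = 0 := rfl

@[simp] theorem excess_coe (j s : ℝ) : excess (j : WithTop ℝ) s = max (s - j) 0 := rfl

/-- The lattice map of the (modified) ultra-discrete KdV equation with parameters `J`, `K`. -/
def F (J K : WithTop ℝ) (p : ℝ × ℝ) : ℝ × ℝ :=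
  (p.2 - excess J (p.1 + p.2) + excess K (p.1 + p.2),
   p.1 - excess K (p.1 + p.2) + excess J (p.1 + p.2))

/-- `(p.1 t n, p.2 t n)` are the variables at site `n` and time `t` (so `p.1 t n` is the
configuration variable and `p.2 t n` the carrier variable) of a solution of the initial value
problem with initial configuration `x`. -/
def IsSolution (J K : WithTop ℝ) (x : ℤ → ℝ) (p : (ℤ → ℤ → ℝ) × (ℤ → ℤ → ℝ)) : Prop :=
  (∀ n t : ℤ, F J K (p.1 t n, p.2 t (n - 1)) = (p.1 (t + 1) n, p.2 t n)) ∧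
    ∀ n : ℤ, p.1 0 n = x n

/-- `u` is a carrier path for the single configuration `x`. -/
def IsCarrier (J K : WithTop ℝ) (x u : ℤ → ℝ) : Prop :=
  ∀ n : ℤ, (F J K (x n, u (n - 1))).2 = u n

/-- The configurations for which the initial value problem (over all times in `ℤ`) has a unique
solution. -/
def XStar (J K : WithTop ℝ) : Set (ℤ → ℝ) := {x | ∃! p, IsSolution J K x p}

/-- The configurations that have a unique carrier path. -/
def XUniq (J K : WithTop ℝ) : Set (ℤ → ℝ) := {x | ∃! u, IsCarrier J K x u}

open Classical in
/-- The carrier `U(x)`: on `XStar` it is the time-zero carrier of the unique solution of the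
initial value problem, on `XUniq` it is the unique carrier path (the two agree where both apply,
see `carrier_eq_of_mem_XUniq`). Outside these sets the value is irrelevant. -/
def carrier (J K : WithTop ℝ) (x : ℤ → ℝ) : ℤ → ℝ :=
  if h : x ∈ XStar J K then h.choose.2 0
  else if h : x ∈ XUniq J K then h.choose
  else 0

theorem carrier_eq_of_isSolution {J K : WithTop ℝ} {x : ℤ → ℝ} (hx : x ∈ XStar J K)
    {p : (ℤ → ℤ → ℝ) × (ℤ → ℤ → ℝ)} (hp : IsSolution J K x p) : carrier J K x = p.2 0 := by
  unfold carrier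
  rw [dif_pos hx, ← hx.choose_spec.2 p hp]

theorem carrier_eq_of_mem_XUniq {J K : WithTop ℝ} {x u : ℤ → ℝ} (hx : x ∈ XUniq J K)
    (hu : IsCarrier J K x u) : carrier J K x = u := by
  by_cases h : x ∈ XStar J K
  · refine hx.unique ?_ hu
    obtain ⟨p, hp, -⟩ := id h
    rw [carrier_eq_of_isSolution h hp]
    intro n
    have h1 := hp.1 n 0
    rw [hp.2 n] at h1
    rw [h1]
  · unfold carrier
    rw [dif_neg h, dif_pos hx]
    exact (hx.choose_spec.2 u hu).symm

/-- One time step of the dynamics, `T(x)_n = F^{(1)}(x_n, U_{n-1}(x))`. -/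
def dynamics (J K : WithTop ℝ) (x : ℤ → ℝ) : ℤ → ℝ :=
  fun n => (F J K (x n, carrier J K x (n - 1))).1

theorem dynamics_eq_of_isSolution {J K : WithTop ℝ} {x : ℤ → ℝ} (hx : x ∈ XStar J K)
    {p : (ℤ → ℤ → ℝ) × (ℤ → ℤ → ℝ)} (hp : IsSolution J K x p) : dynamics J K x = p.1 1 := by
  funext n
  have h1 := hp.1 n 0
  rw [hp.2 n] at h1
  simp only [dynamics, carrier_eq_of_isSolution hx hp, h1, zero_add]

/-- The law `μ^ℤ` of an i.i.d. configuration with marginal `μ`. -/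
def iidLaw (μ : Measure ℝ) [IsProbabilityMeasure μ] : Measure (ℤ → ℝ) :=
  Measure.infinitePi (fun _ : ℤ => μ)

/-- `T μ^ℤ = μ^ℤ`: almost every configuration leads to a unique solution of the initial value
problem, so that `T` is defined almost everywhere, and the image of `μ^ℤ` under `T` is `μ^ℤ`. -/
def IsInvariant (J K : WithTop ℝ) (μ : Measure ℝ) [IsProbabilityMeasure μ] : Prop :=
  (∀ᵐ x ∂(iidLaw μ), x ∈ XStar J K) ∧ AEMeasurable (dynamics J K) (iidLaw μ) ∧
    (iidLaw μ).map (dynamics J K) = iidLaw μ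

/-- The normalization `m / m(ℝ)` of a measure with `0 < m(ℝ) < ∞`. -/
def normalize (m : Measure ℝ) : Measure ℝ := (m Set.univ)⁻¹ • m

theorem isProbabilityMeasure_normalize {m : Measure ℝ} (h0 : m Set.univ ≠ 0)
    (h1 : m Set.univ ≠ ⊤) : IsProbabilityMeasure (normalize m) :=
  ⟨by simpa [normalize] using ENNReal.inv_mul_cancel h0 h1⟩

/-- The shifted truncated exponential distribution: density proportional to `exp (-lam * x)` on
`[c₁, c₂]`. For `c₂ = ∞` (and `lam > 0`) this is the shifted exponential distribution. -/
def stExp (lam c₁ : ℝ) (c₂ : WithTop ℝ) : Measure ℝ :=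
  normalize ((volume.restrict {x : ℝ | c₁ ≤ x ∧ (x : WithTop ℝ) ≤ c₂}).withDensity
    (fun x => ENNReal.ofReal (Real.exp (-lam * x))))

theorem isProbabilityMeasure_stExp {lam c₁ : ℝ} {c₂ : WithTop ℝ} (hc : (c₁ : WithTop ℝ) < c₂)
    (hlam : c₂ = ⊤ → 0 < lam) : IsProbabilityMeasure (stExp lam c₁ c₂) := by
  have key : ∀ S : Set ℝ, MeasurableSet S → volume S ≠ 0 →
      IntegrableOn (fun x : ℝ => Real.exp (-lam * x)) S →
      IsProbabilityMeasure (normalize ((volume.restrict S).withDensity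
        (fun x => ENNReal.ofReal (Real.exp (-lam * x))))) := by
    intro S hS h0 hint
    refine isProbabilityMeasure_normalize ?_ ?_
    · rw [withDensity_apply _ MeasurableSet.univ, Measure.restrict_univ]
      intro h
      rw [lintegral_eq_zero_iff (by fun_prop)] at h
      have h2 : ∀ᵐ x ∂(volume.restrict S), False := by
        filter_upwards [h] with x hx
        simp only [Pi.zero_apply, ENNReal.ofReal_eq_zero] at hx
        exact absurd (Real.exp_pos (-lam * x)) (not_lt.mpr hx)
      rw [Filter.eventually_false_iff_eq_bot, ae_eq_bot, Measure.restrict_eq_zero] at h2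
      exact h0 h2
    · rw [withDensity_apply _ MeasurableSet.univ, Measure.restrict_univ]
      exact hint.lintegral_lt_top.ne
  unfold stExp
  induction c₂ using WithTop.recTopCoe with
  | top =>
    have hs : {x : ℝ | c₁ ≤ x ∧ (x : WithTop ℝ) ≤ ⊤} = Set.Ici c₁ := by
      ext x; simp
    rw [hs]
    refine key _ measurableSet_Ici (by simp) ?_
    rw [integrableOn_Ici_iff_integrableOn_Ioi]
    exact integrableOn_exp_mul_Ioi (by simpa using hlam rfl) c₁
  | coe b =>
    have hs : {x : ℝ | c₁ ≤ x ∧ (x : WithTop ℝ) ≤ (b : WithTop ℝ)} = Set.Icc c₁ b := by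
      ext x; simp
    have hb : c₁ < b := by exact_mod_cast hc
    rw [hs]
    refine key _ measurableSet_Icc (by simpa using hb) ?_
    exact Continuous.integrableOn_Icc (by fun_prop)

/-- The shifted scaled truncated bipartite geometric distribution `sstbGeo(1 - θ, M, N, κ, m)`:
for the integers `x` with `M ≤ x ≤ N`, the point `m * x` has mass proportional to `θ ^ x` if `x` is
even and to `θ ^ x * κ` if `x` is odd. -/
def sstbGeo (θ : ℝ) (M : ℤ) (N : WithTop ℤ) (κ m : ℝ) : Measure ℝ :=
  normalize (Measure.sum (fun x : {x : ℤ // M ≤ x ∧ (x : WithTop ℤ) ≤ N} =>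
    ENNReal.ofReal (θ ^ (x : ℤ) * (if Even (x : ℤ) then 1 else κ)) •
      Measure.dirac (m * ((x : ℤ) : ℝ))))

theorem isProbabilityMeasure_sstbGeo {θ : ℝ} {M : ℤ} {N : WithTop ℤ} {κ m : ℝ} (hθ : 0 < θ)
    (hκ : 0 < κ) (hMN : (M : WithTop ℤ) ≤ N) (hN : N = ⊤ → θ < 1) :
    IsProbabilityMeasure (sstbGeo θ M N κ m) := by
  have hpos : ∀ x : ℤ, 0 < θ ^ x * (if Even x then 1 else κ) := by
    intro x
    have := zpow_pos hθ x
    split_ifs <;> positivity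
  refine isProbabilityMeasure_normalize ?_ ?_
  · rw [Measure.sum_apply _ MeasurableSet.univ]
    intro h
    rw [ENNReal.tsum_eq_zero] at h
    have h1 := h ⟨M, le_rfl, hMN⟩
    simp only [Measure.smul_apply, measure_univ, smul_eq_mul, mul_one,
      ENNReal.ofReal_eq_zero] at h1
    exact absurd (hpos M) (not_lt.mpr h1)
  · rw [Measure.sum_apply _ MeasurableSet.univ]
    simp only [Measure.smul_apply, measure_univ, smul_eq_mul, mul_one]
    induction N using WithTop.recTopCoe with
    | top =>
      have hθ1 := hN rfl
      let e : ℕ → {x : ℤ // M ≤ x ∧ (x : WithTop ℤ) ≤ ⊤} := fun n => ⟨M + n, by omega, le_top⟩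
      have he : Function.Surjective e := by
        rintro ⟨x, hx, -⟩
        refine ⟨(x - M).toNat, ?_⟩
        simp only [e, Subtype.mk.injEq]
        omega
      have hs : Summable (fun n : ℕ => θ ^ M * (1 + κ) * θ ^ n) :=
        (summable_geometric_of_lt_one hθ.le hθ1).mul_left _
      refine ne_top_of_le_ne_top hs.tsum_ofReal_ne_top ?_
      refine (ENNReal.tsum_le_tsum_comp_of_surjective he _).trans (ENNReal.tsum_le_tsum fun n => ?_)
      refine ENNReal.ofReal_le_ofReal ?_
      have h1 : θ ^ (M + (n : ℤ)) = θ ^ M * θ ^ n := by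
        rw [zpow_add₀ hθ.ne', zpow_natCast]
      have h2 : (if Even (M + (n : ℤ)) then (1 : ℝ) else κ) ≤ 1 + κ := by
        split_ifs <;> linarith
      have h3 : 0 < θ ^ M * θ ^ n := mul_pos (zpow_pos hθ M) (pow_pos hθ n)
      simp only [e, h1]
      nlinarith [mul_le_mul_of_nonneg_left h2 h3.le]
    | coe b =>
      have hfin : Finite {x : ℤ // M ≤ x ∧ (x : WithTop ℤ) ≤ (b : WithTop ℤ)} := by
        refine Set.Finite.to_subtype ((Set.finite_Icc M b).subset ?_)
        rintro x ⟨h1, h2⟩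
        exact ⟨h1, by exact_mod_cast h2⟩
      have := Fintype.ofFinite {x : ℤ // M ≤ x ∧ (x : WithTop ℤ) ≤ (b : WithTop ℤ)}
      rw [tsum_fintype]
      exact ENNReal.sum_ne_top.mpr fun _ _ => ENNReal.ofReal_ne_top

/-- `a - c` for `a` in `ℝ ∪ {∞}` and `c` real. -/
def sub (a : WithTop ℝ) (c : ℝ) : WithTop ℝ := a.map (fun y => y - c)

/-- `a ∈ hℤ ∪ {∞}`. -/
def InLattice (h : ℝ) (a : WithTop ℝ) : Prop :=
  a = ⊤ ∨ ∃ i : ℤ, a = ((h * (i : ℝ) : ℝ) : WithTop ℝ)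

/-- The exponential family for the parameters `J`, `K`:
`μ = stExp(lam, c, J - c)` with `c < min {J/2, K/2}`, and `lam > 0` unless `J, K < ∞`. -/
def IsExpMarginal (J K : WithTop ℝ) (μ : Measure ℝ) : Prop :=
  ∃ lam c : ℝ, ((2 * c : ℝ) : WithTop ℝ) < J ∧ ((2 * c : ℝ) : WithTop ℝ) < K ∧
    ((J = ⊤ ∨ K = ⊤) → 0 < lam) ∧ μ = stExp lam c (sub J c)

/-- The geometric family for the parameters `J`, `K`:
`μ = sstbGeo(1 - θ, c/m, (J - c)/m, κ, m)`, where `M = c/m` and `N = (J - c)/m`. -/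
def IsGeoMarginal (J K : WithTop ℝ) (μ : Measure ℝ) : Prop :=
  ∃ (c m θ κ : ℝ) (M : ℤ) (N : WithTop ℤ),
    ((2 * c : ℝ) : WithTop ℝ) < J ∧ ((2 * c : ℝ) : WithTop ℝ) < K ∧ 0 < m ∧
    InLattice m (c : WithTop ℝ) ∧ InLattice m J ∧ InLattice m K ∧
    ((InLattice m (sub J (2 * c)) ∧ InLattice m (sub K (2 * c)) ∧
        0 < θ ∧ θ < 1 ∧ κ = 1) ∨
      (InLattice (2 * m) (sub J (2 * c)) ∧ InLattice (2 * m) (sub K (2 * c)) ∧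
        0 < θ ∧ θ < 1 ∧ 0 < κ ∧ κ ≠ 1) ∨
      (J ≠ ⊤ ∧ K ≠ ⊤ ∧ InLattice m (sub J (2 * c)) ∧ InLattice m (sub K (2 * c)) ∧
        1 ≤ θ ∧ κ = 1) ∨
      (J ≠ ⊤ ∧ K ≠ ⊤ ∧ InLattice (2 * m) (sub J (2 * c)) ∧ InLattice (2 * m) (sub K (2 * c)) ∧
        1 ≤ θ ∧ 0 < κ ∧ κ ≠ 1)) ∧
    c = m * (M : ℝ) ∧ sub J c = N.map (fun i : ℤ => m * (i : ℝ)) ∧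
    μ = sstbGeo θ M N κ m

/-- `μ` is supported on the closed set `S`. -/
def SupportedOn (μ : Measure ℝ) (S : Set ℝ) : Prop := μ Sᶜ = 0

end

end UdKdV

namespace UdKdV

open Filter Topology

/-! ### Viable carriers and the initial value problem -/

theorem F_involutive (J K : WithTop ℝ) (p : ℝ × ℝ) : F J K (F J K p) = p := by
  -- Both excess terms depend on the pair only through this conserved sum, so they cancel on the
  -- second application.
  have h : (F J K p).1 + (F J K p).2 = p.1 + p.2 := by simp only [F]; ring
  ext
  · change (F J K p).2 - excess J ((F J K p).1 + (F J K p).2) +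
      excess K ((F J K p).1 + (F J K p).2) = p.1
    rw [h]; simp only [F]; ring
  · change (F J K p).1 - excess K ((F J K p).1 + (F J K p).2) +
      excess J ((F J K p).1 + (F J K p).2) = p.2
    rw [h]; simp only [F]; ring

theorem F_eq_comm {J K : WithTop ℝ} {p q : ℝ × ℝ} (h : F J K p = q) : F J K q = p := by
  rw [← h, F_involutive]

/-- The configuration obtained from `x` when it is traversed by the carrier `u`. -/
def output (J K : WithTop ℝ) (x u : ℤ → ℝ) : ℤ → ℝ := fun n => (F J K (x n, u (n - 1))).1

theorem IsCarrier.F_eq {J K : WithTop ℝ} {x u : ℤ → ℝ} (h : IsCarrier J K x u) (n : ℤ) :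
    F J K (x n, u (n - 1)) = (output J K x u n, u n) :=
  Prod.ext rfl (h n)

/-- `u` is a carrier for `x`, and the only one whose output has a carrier again. -/
def IsViableCarrier (J K : WithTop ℝ) (x u : ℤ → ℝ) : Prop :=
  IsCarrier J K x u ∧
    ∀ u', IsCarrier J K x u' → (∃ v, IsCarrier J K (output J K x u') v) → u' = u

theorem isViableCarrier_of_unique {J K : WithTop ℝ} {x u : ℤ → ℝ} (h : IsCarrier J K x u)
    (h' : ∀ u', IsCarrier J K x u' → u' = u) : IsViableCarrier J K x u :=
  ⟨h, fun u' hu' _ => h' u' hu'⟩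

/-- `y` is the output of `x` along its viable carrier. -/
def IsStep (J K : WithTop ℝ) (x y : ℤ → ℝ) : Prop :=
  ∃ u, IsViableCarrier J K x u ∧ y = output J K x u

/-- The space reflection `n ↦ -n` of a configuration. -/
def reflect (x : ℤ → ℝ) : ℤ → ℝ := fun n => x (-n)

/-- The reflection of a solution in space and time. -/
def reflectSolution (p : (ℤ → ℤ → ℝ) × (ℤ → ℤ → ℝ)) : (ℤ → ℤ → ℝ) × (ℤ → ℤ → ℝ) :=
  (fun t n => p.1 (-t) (-n), fun t n => p.2 (-t - 1) (-n - 1))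

/-- Involutivity lets each lattice relation be read with inputs and outputs exchanged. The carrier
indices move by one because `p.2 t n` sits between the sites `n` and `n + 1` and between the times
`t` and `t + 1`. -/
theorem IsSolution.reflect {J K : WithTop ℝ} {x : ℤ → ℝ} {p : (ℤ → ℤ → ℝ) × (ℤ → ℤ → ℝ)}
    (h : IsSolution J K x p) : IsSolution J K (reflect x) (reflectSolution p) := by
  refine ⟨fun n t => ?_, fun n => ?_⟩
  · have h1 := F_eq_comm (h.1 (-n) (-t - 1))
    simp only [reflectSolution]
    rw [show -t - 1 + 1 = -t by ring] at h1
    rw [show -(n - 1) - 1 = -n by ring, h1, show -(t + 1) = -t - 1 by ring]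
  · simp [reflectSolution, UdKdV.reflect, h.2]

theorem IsSolution.isCarrier {J K : WithTop ℝ} {x : ℤ → ℝ} {p : (ℤ → ℤ → ℝ) × (ℤ → ℤ → ℝ)}
    (h : IsSolution J K x p) (t : ℤ) : IsCarrier J K (p.1 t) (p.2 t) := fun n => by
  rw [h.1 n t]

theorem IsSolution.output_eq {J K : WithTop ℝ} {x : ℤ → ℝ} {p : (ℤ → ℤ → ℝ) × (ℤ → ℤ → ℝ)}
    (h : IsSolution J K x p) (t : ℤ) : output J K (p.1 t) (p.2 t) = p.1 (t + 1) := by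
  funext n
  simp only [output, h.1 n t]

/-- The carrier at time `t + 1` is itself the witness that the output at time `t` can be continued,
so viability applies. -/
theorem IsSolution.eq_of_isViableCarrier {J K : WithTop ℝ} {x u : ℤ → ℝ}
    {p : (ℤ → ℤ → ℝ) × (ℤ → ℤ → ℝ)} (h : IsSolution J K x p) {t : ℤ}
    (hu : IsViableCarrier J K (p.1 t) u) : p.2 t = u :=
  hu.2 _ (h.isCarrier t) ⟨p.2 (t + 1), by rw [h.output_eq]; exact h.isCarrier _⟩

theorem IsSolution.eq_iterate {J K : WithTop ℝ} {x : ℤ → ℝ} {T : (ℤ → ℝ) → ℤ → ℝ}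
    (hT : ∀ t : ℕ, IsStep J K (T^[t] x) (T (T^[t] x)))
    {p : (ℤ → ℤ → ℝ) × (ℤ → ℤ → ℝ)} (h : IsSolution J K x p) (t : ℕ) :
    p.1 t = T^[t] x := by
  induction t with
  | zero => funext n; simpa using h.2 n
  | succ t ih =>
    obtain ⟨u, hu, hy⟩ := hT t
    rw [← ih] at hu
    rw [Function.iterate_succ_apply', hy, ← ih, Nat.cast_succ, ← h.output_eq,
      h.eq_of_isViableCarrier hu]

theorem IsSolution.eq_forward {J K : WithTop ℝ} {x : ℤ → ℝ} {T : (ℤ → ℝ) → ℤ → ℝ}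
    (hT : ∀ t : ℕ, IsStep J K (T^[t] x) (T (T^[t] x)))
    {p q : (ℤ → ℤ → ℝ) × (ℤ → ℤ → ℝ)} (hp : IsSolution J K x p) (hq : IsSolution J K x q)
    (t : ℕ) : p.1 t = q.1 t ∧ p.2 t = q.2 t := by
  have h1 := hp.eq_iterate hT t
  have h2 := hq.eq_iterate hT t
  obtain ⟨u, hu, -⟩ := hT t
  refine ⟨h1.trans h2.symm, ?_⟩
  rw [hp.eq_of_isViableCarrier (h1.symm ▸ hu), hq.eq_of_isViableCarrier (h2.symm ▸ hu)]

/-- Nonnegative times are built by iterating on `x`, negative times by iterating on its reflection.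
Uniqueness is the forward uniqueness applied to a solution and to its reflection. -/
theorem mem_XStar_of_isStep {J K : WithTop ℝ} {x : ℤ → ℝ} {T : (ℤ → ℝ) → ℤ → ℝ}
    (hT : ∀ t : ℕ, IsStep J K (T^[t] x) (T (T^[t] x)))
    (hT' : ∀ t : ℕ, IsStep J K (T^[t] (reflect x)) (T (T^[t] (reflect x)))) :
    x ∈ XStar J K := by
  choose u hu hy using hT
  choose v hv hz using hT'
  let p : (ℤ → ℤ → ℝ) × (ℤ → ℤ → ℝ) :=
    (fun t n => if 0 ≤ t then T^[t.toNat] x n else T^[(-t).toNat] (reflect x) (-n),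
      fun t n => if 0 ≤ t then u t.toNat n else v (-t - 1).toNat (-n - 1))
  have hp : IsSolution J K x p := by
    refine ⟨fun n t => ?_, fun n => by simp [p]⟩
    rcases lt_or_ge t 0 with ht | ht
    · obtain ⟨s, rfl⟩ : ∃ s : ℕ, t = -(s : ℤ) - 1 := ⟨(-t - 1).toNat, by omega⟩
      have h1 : p.1 (-(s : ℤ) - 1 + 1) n = T^[s] (reflect x) (-n) := by
        -- At `s = 0` the two halves meet: time `0` belongs to the nonnegative branch, and both
        -- branches give `x` there.
        rcases Nat.eq_zero_or_pos s with rfl | hs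
        · simp [p, reflect]
        · have : ¬ (0 ≤ -(s : ℤ) - 1 + 1) := by omega
          have h' : (-(-(s : ℤ) - 1 + 1)).toNat = s := by omega
          simp only [p, this, if_false, h']
      have h2 : p.1 (-(s : ℤ) - 1) n = T^[s + 1] (reflect x) (-n) := by
        have : ¬ (0 ≤ -(s : ℤ) - 1) := by omega
        have h' : (-(-(s : ℤ) - 1)).toNat = s + 1 := by omega
        simp only [p, this, if_false, h']
      have h3 : ∀ k, p.2 (-(s : ℤ) - 1) k = v s (-k - 1) := by
        intro k
        have : ¬ (0 ≤ -(s : ℤ) - 1) := by omega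
        have h' : (-(-(s : ℤ) - 1) - 1).toNat = s := by omega
        simp only [p, this, if_false, h']
      rw [h1, h2, h3, h3]
      apply F_eq_comm
      rw [(hv s).1.F_eq (-n), ← hz s, Function.iterate_succ_apply',
        show -(n - 1) - 1 = -n by ring]
    · have h2 : (t + 1).toNat = t.toNat + 1 := by omega
      simp only [p, ht, if_true, show (0 : ℤ) ≤ t + 1 by omega, h2, Function.iterate_succ_apply',
        hy t.toNat]
      exact (hu t.toNat).1.F_eq n
  refine ⟨p, hp, fun q hq => ?_⟩
  have hT : ∀ t : ℕ, IsStep J K (T^[t] x) (T (T^[t] x)) := fun t => ⟨u t, hu t, hy t⟩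
  have hT' : ∀ t : ℕ, IsStep J K (T^[t] (reflect x)) (T (T^[t] (reflect x))) :=
    fun t => ⟨v t, hv t, hz t⟩
  have h1 := hq.eq_forward hT hp
  have h2 := hq.reflect.eq_forward hT' hp.reflect
  have key1 : ∀ t n, q.1 t n = p.1 t n := by
    intro t n
    rcases lt_or_ge t 0 with ht | ht
    · have h := congrFun (h2 (-t).toNat).1 (-n)
      simpa [reflectSolution, Int.toNat_of_nonneg (show 0 ≤ -t by omega)] using h
    · have h := congrFun (h1 t.toNat).1 n
      simpa [Int.toNat_of_nonneg ht] using h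
  have key2 : ∀ t n, q.2 t n = p.2 t n := by
    intro t n
    rcases lt_or_ge t 0 with ht | ht
    · have h := congrFun (h2 (-t - 1).toNat).2 (-n - 1)
      simp only [reflectSolution, Int.toNat_of_nonneg (show 0 ≤ -t - 1 by omega)] at h
      simpa only [neg_sub, sub_neg_eq_add, add_sub_cancel, add_sub_cancel_left, neg_neg] using h
    · have h := congrFun (h1 t.toNat).2 n
      simpa [Int.toNat_of_nonneg ht] using h
  ext t n
  · exact key1 t n
  · exact key2 t n

theorem dynamics_eq_of_isStep {J K : WithTop ℝ} {x y : ℤ → ℝ} (hx : x ∈ XStar J K)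
    (h : IsStep J K x y) : dynamics J K x = y := by
  obtain ⟨u, hu, rfl⟩ := h
  obtain ⟨p, hp, -⟩ := id hx
  have h0 : p.1 0 = x := funext hp.2
  have h1 := hp.output_eq 0
  rw [h0, hp.eq_of_isViableCarrier (t := 0) (h0.symm ▸ hu)] at h1
  rw [dynamics_eq_of_isSolution hx hp, h1, zero_add]

theorem mem_XUniq_of_unique {J K : WithTop ℝ} {x u : ℤ → ℝ} (h : IsCarrier J K x u)
    (h' : ∀ u', IsCarrier J K x u' → u' = u) : x ∈ XUniq J K :=
  ⟨u, h, h'⟩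

/-! ### The i.i.d. law and reduction to a single time step -/

instance (μ : Measure ℝ) [IsProbabilityMeasure μ] : IsProbabilityMeasure (iidLaw μ) := by
  unfold iidLaw; infer_instance

theorem measurePreserving_iidLaw_comp (μ : Measure ℝ) [IsProbabilityMeasure μ] (e : ℤ ≃ ℤ) :
    MeasurePreserving (fun (x : ℤ → ℝ) n => x (e n)) (iidLaw μ) (iidLaw μ) := by
  have hm : Measurable (fun (x : ℤ → ℝ) n => x (e n)) := by fun_prop
  refine ⟨hm, ?_⟩
  unfold iidLaw
  refine Measure.eq_infinitePi _ fun s t ht => ?_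
  have hpre : (fun (x : ℤ → ℝ) n => x (e n)) ⁻¹' (Set.pi s t) =
      Set.pi (s.map e.toEmbedding) (fun n => t (e.symm n)) := by
    ext x
    simp only [Set.mem_preimage, Set.mem_pi, Finset.mem_coe, Finset.mem_map_equiv]
    exact ⟨fun h i hi => by simpa using h _ hi, fun h i hi => by simpa using h (e i) (by simpa)⟩
  rw [Measure.map_apply hm (.pi s.countable_toSet fun i _ => ht i), hpre,
    Measure.infinitePi_pi _ (fun i _ => ht _)]
  simp

theorem measurePreserving_reflect (μ : Measure ℝ) [IsProbabilityMeasure μ] :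
    MeasurePreserving reflect (iidLaw μ) (iidLaw μ) :=
  measurePreserving_iidLaw_comp μ (Equiv.neg ℤ)

/-- Invariance of the law carries the almost sure one-step property along all iterates of `T`;
reflection invariance of the law then supplies the same for the past. -/
theorem isInvariant_of_isStep {J K : WithTop ℝ} {μ : Measure ℝ} [IsProbabilityMeasure μ]
    {T : (ℤ → ℝ) → ℤ → ℝ} (hT : ∀ᵐ x ∂(iidLaw μ), IsStep J K x (T x))
    (hm : AEMeasurable T (iidLaw μ)) (hmap : (iidLaw μ).map T = iidLaw μ) :
    IsInvariant J K μ := by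
  have hit : ∀ t : ℕ, ∀ᵐ x ∂(iidLaw μ), IsStep J K (T^[t] x) (T (T^[t] x)) := by
    intro t
    induction t with
    | zero => simpa using hT
    | succ t ih =>
      rw [← hmap] at ih
      simpa using ae_of_ae_map hm ih
  rw [← ae_all_iff] at hit
  have hit' := (measurePreserving_reflect μ).quasiMeasurePreserving.ae hit
  have hX : ∀ᵐ x ∂(iidLaw μ), x ∈ XStar J K := by
    filter_upwards [hit, hit'] with x h1 h2 using mem_XStar_of_isStep h1 h2
  have heq : dynamics J K =ᵐ[iidLaw μ] T := by
    filter_upwards [hX, hT] with x h1 h2 using dynamics_eq_of_isStep h1 h2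
  exact ⟨hX, hm.congr heq.symm, (Measure.map_congr heq).trans hmap⟩

/-- The space shift of a configuration by one site to the right. -/
def shift (x : ℤ → ℝ) : ℤ → ℝ := fun n => x (n - 1)

theorem measurePreserving_shift (μ : Measure ℝ) [IsProbabilityMeasure μ] :
    MeasurePreserving shift (iidLaw μ) (iidLaw μ) :=
  measurePreserving_iidLaw_comp μ (Equiv.subRight 1)

theorem isInvariant_of_isStep_shift {J K : WithTop ℝ} {μ : Measure ℝ} [IsProbabilityMeasure μ]
    (h : ∀ᵐ x ∂(iidLaw μ), IsStep J K x (shift x)) : IsInvariant J K μ :=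
  isInvariant_of_isStep h (measurePreserving_shift μ).measurable.aemeasurable
    (measurePreserving_shift μ).map_eq

/-! ### Finite sweeps preserve the product law -/

theorem measurable_excess (J : WithTop ℝ) : Measurable (excess J) := by
  induction J using WithTop.recTopCoe with
  | top => exact measurable_const
  | coe j => exact (measurable_id.sub_const j).max measurable_const

theorem measurable_F (J K : WithTop ℝ) : Measurable (F J K) := by
  have h1 : Measurable (fun p : ℝ × ℝ => excess J (p.1 + p.2)) :=
    (measurable_excess J).comp (by fun_prop)
  have h2 : Measurable (fun p : ℝ × ℝ => excess K (p.1 + p.2)) :=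
    (measurable_excess K).comp (by fun_prop)
  unfold F
  fun_prop

/-- Resampling one site independently does not change the law. This isolates a site without
splitting `ℤ` into that site and its complement. -/
theorem measurePreserving_update_iidLaw (μ : Measure ℝ) [IsProbabilityMeasure μ] (n : ℤ) :
    MeasurePreserving (fun q : ℝ × (ℤ → ℝ) => Function.update q.2 n q.1)
      (μ.prod (iidLaw μ)) (iidLaw μ) := by
  have hm : Measurable (fun q : ℝ × (ℤ → ℝ) => Function.update q.2 n q.1) := by
    rw [measurable_pi_iff]
    intro k
    by_cases hk : k = n
    · subst hk; simpa using measurable_fst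
    · simp only [Function.update_of_ne hk]; fun_prop
  refine ⟨hm, ?_⟩
  conv_rhs => rw [iidLaw]
  refine Measure.eq_infinitePi _ fun s t ht => ?_
  have hpre : (fun q : ℝ × (ℤ → ℝ) => Function.update q.2 n q.1) ⁻¹' (Set.pi s t) =
      (if n ∈ s then t n else Set.univ) ×ˢ Set.pi (s.erase n) t := by
    ext ⟨z, x⟩
    simp only [Set.mem_preimage, Set.mem_pi, Finset.mem_coe, Set.mem_prod, Finset.mem_erase]
    constructor
    · refine fun h => ⟨?_, fun i hi => by simpa [hi.1] using h i hi.2⟩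
      split_ifs with hn
      · simpa using h n hn
      · trivial
    · rintro ⟨h1, h2⟩ i hi
      by_cases hin : i = n
      · subst hin; simpa [hi] using h1
      · simpa [hin] using h2 i ⟨hin, hi⟩
  rw [Measure.map_apply hm (.pi s.countable_toSet fun i _ => ht i), hpre, Measure.prod_prod,
    iidLaw, Measure.infinitePi_pi _ (fun i _ => ht _)]
  split_ifs with hn
  · rw [Finset.mul_prod_erase s (fun i => μ (t i)) hn]
  · simp [Finset.erase_eq_of_notMem hn]

/-- Traversal of the site `n` of a configuration by a carrier. -/
def siteUpdate (J K : WithTop ℝ) (n : ℤ) (p : (ℤ → ℝ) × ℝ) : (ℤ → ℝ) × ℝ :=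
  (Function.update p.1 n (F J K (p.1 n, p.2)).1, (F J K (p.1 n, p.2)).2)

theorem measurable_siteUpdate (J K : WithTop ℝ) (n : ℤ) : Measurable (siteUpdate J K n) := by
  have h : Measurable (fun p : (ℤ → ℝ) × ℝ => F J K (p.1 n, p.2)) :=
    (measurable_F J K).comp (by fun_prop)
  refine Measurable.prodMk ?_ h.snd
  rw [measurable_pi_iff]
  intro k
  by_cases hk : k = n
  · subst hk; simpa using h.fst
  · simp only [Function.update_of_ne hk]; fun_prop

/-- Insert the first component of an independent pair at site `n` and let the second be the carrier:
this map `e` intertwines `F × id` with the site update. -/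
theorem measurePreserving_siteUpdate {J K : WithTop ℝ} {μ ν : Measure ℝ} [IsProbabilityMeasure μ]
    [IsProbabilityMeasure ν] (hF : MeasurePreserving (F J K) (μ.prod ν) (μ.prod ν)) (n : ℤ) :
    MeasurePreserving (siteUpdate J K n) ((iidLaw μ).prod ν) ((iidLaw μ).prod ν) := by
  let e : (ℝ × ℝ) × (ℤ → ℝ) → (ℤ → ℝ) × ℝ := fun q => (Function.update q.2 n q.1.1, q.1.2)
  have he : MeasurePreserving e ((μ.prod ν).prod (iidLaw μ)) ((iidLaw μ).prod ν) := by
    have h1 : MeasurePreserving (Prod.map Prod.swap id)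
        ((μ.prod ν).prod (iidLaw μ)) ((ν.prod μ).prod (iidLaw μ)) :=
      Measure.measurePreserving_swap.prod (.id _)
    have h2 := measurePreserving_prodAssoc ν μ (iidLaw μ)
    have h3 := (MeasurePreserving.id ν).prod (measurePreserving_update_iidLaw μ n)
    exact Measure.measurePreserving_swap.comp (h3.comp (h2.comp h1))
  have hcomp : siteUpdate J K n ∘ e = e ∘ Prod.map (F J K) id := by
    funext q
    simp [siteUpdate, e]
  refine ⟨measurable_siteUpdate J K n, ?_⟩
  conv_lhs => rw [← he.map_eq]
  rw [Measure.map_map (measurable_siteUpdate J K n) he.measurable, hcomp]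
  exact (he.comp (hF.prod (.id _))).map_eq

/-- Traversal of the sites `m + 1, …, m + r` by a carrier. -/
def sweep (J K : WithTop ℝ) (m : ℤ) : ℕ → (ℤ → ℝ) × ℝ → (ℤ → ℝ) × ℝ
  | 0 => id
  | r + 1 => siteUpdate J K (m + r + 1) ∘ sweep J K m r

theorem measurable_sweep (J K : WithTop ℝ) (m : ℤ) (r : ℕ) : Measurable (sweep J K m r) := by
  induction r with
  | zero => exact measurable_id
  | succ r ih => exact (measurable_siteUpdate _ _ _).comp ih

theorem measurePreserving_sweep {J K : WithTop ℝ} {μ ν : Measure ℝ} [IsProbabilityMeasure μ]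
    [IsProbabilityMeasure ν] (hF : MeasurePreserving (F J K) (μ.prod ν) (μ.prod ν)) (m : ℤ)
    (r : ℕ) : MeasurePreserving (sweep J K m r) ((iidLaw μ).prod ν) ((iidLaw μ).prod ν) := by
  induction r with
  | zero => exact .id _
  | succ r ih => exact (measurePreserving_siteUpdate hF _).comp ih

/-! ### Carriers started far to the left, and the limit of sweeps -/

/-- `v` satisfies the carrier recursion to the right of the site `m`. -/
def IsCarrierFrom (J K : WithTop ℝ) (x : ℤ → ℝ) (m : ℤ) (v : ℤ → ℝ) : Prop :=
  ∀ k, m < k → (F J K (x k, v (k - 1))).2 = v k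

/-- The carrier started from the value `U` at the site `m`. -/
def carrierFrom (J K : WithTop ℝ) (x : ℤ → ℝ) (m : ℤ) (U : ℝ) : ℤ → ℝ := fun k =>
  Nat.rec U (fun r u => (F J K (x (m + r + 1), u)).2) (k - m).toNat

theorem carrierFrom_self (J K : WithTop ℝ) (x : ℤ → ℝ) (m : ℤ) (U : ℝ) :
    carrierFrom J K x m U m = U := by
  simp [carrierFrom]

theorem isCarrierFrom_carrierFrom (J K : WithTop ℝ) (x : ℤ → ℝ) (m : ℤ) (U : ℝ) :
    IsCarrierFrom J K x m (carrierFrom J K x m U) := by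
  intro k hk
  obtain ⟨r, rfl⟩ : ∃ r : ℕ, k = m + r + 1 := ⟨(k - m - 1).toNat, by omega⟩
  have h1 : (m + r + 1 - 1 - m).toNat = r := by omega
  have h2 : (m + r + 1 - m).toNat = r + 1 := by omega
  simp only [carrierFrom, h1, h2]

theorem sweep_eq (J K : WithTop ℝ) (x : ℤ → ℝ) (m : ℤ) (U : ℝ) (r : ℕ) :
    (∀ k, (sweep J K m r (x, U)).1 k = if m < k ∧ k ≤ m + r then
        output J K x (carrierFrom J K x m U) k else x k) ∧
      (sweep J K m r (x, U)).2 = carrierFrom J K x m U (m + r) := by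
  induction r with
  | zero =>
    refine ⟨fun k => ?_, by simp [sweep, carrierFrom_self]⟩
    have : ¬ (m < k ∧ k ≤ m + (0 : ℕ)) := by omega
    rw [if_neg this]; rfl
  | succ r ih =>
    obtain ⟨ih1, ih2⟩ := ih
    have h1 : (sweep J K m r (x, U)).1 (m + r + 1) = x (m + r + 1) := by
      rw [ih1, if_neg (by omega)]
    have hrec := isCarrierFrom_carrierFrom J K x m U (m + r + 1) (by omega)
    rw [add_sub_cancel_right] at hrec
    constructor
    · intro k
      simp only [sweep, Function.comp, siteUpdate, h1, ih2]
      by_cases hk : k = m + r + 1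
      · subst hk
        rw [Function.update_self, if_pos (by push_cast; omega)]
        simp [output]
      · rw [Function.update_of_ne hk, ih1]
        congr 1
        simp only [Nat.cast_succ, eq_iff_iff]
        omega
    · simp only [sweep, Function.comp, siteUpdate, h1, ih2, hrec]
      push_cast; ring_nf

/-- Carriers for `x` started far to the left agree locally with `u`. -/
def IsAttracting (J K : WithTop ℝ) (x u : ℤ → ℝ) : Prop :=
  ∀ (U : ℝ) (n : ℤ), ∀ᶠ m in atBot, ∀ v, v m = U → IsCarrierFrom J K x m v → v n = u n

theorem IsAttracting.eventually_sweep {J K : WithTop ℝ} {x u : ℤ → ℝ}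
    (h : IsAttracting J K x u) (U : ℝ) (k : ℤ) :
    ∀ᶠ N : ℕ in atTop, (sweep J K (-N) (2 * N) (x, U)).1 k = output J K x u k := by
  have hbot : Tendsto (fun N : ℕ => -(N : ℤ)) atTop atBot :=
    tendsto_neg_atTop_atBot.comp tendsto_natCast_atTop_atTop
  filter_upwards [hbot.eventually (h U (k - 1)), eventually_gt_atTop k.natAbs] with N hN hk
  rw [(sweep_eq J K x (-N) U (2 * N)).1 k, if_pos (by push_cast; omega)]
  simp only [output, hN _ (carrierFrom_self ..) (isCarrierFrom_carrierFrom _ _ _ _ _)]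

theorem IsAttracting.isCarrier {J K : WithTop ℝ} {x u : ℤ → ℝ}
    (h : IsAttracting J K x u) : IsCarrier J K x u := by
  intro n
  obtain ⟨m, h1, h2, h3⟩ := ((h 0 n).and ((h 0 (n - 1)).and (eventually_lt_atBot n))).exists
  rw [← h1 _ (carrierFrom_self ..) (isCarrierFrom_carrierFrom _ _ _ _ _),
    ← h2 _ (carrierFrom_self ..) (isCarrierFrom_carrierFrom _ _ _ _ _)]
  exact isCarrierFrom_carrierFrom J K x m 0 n h3

/-- With the carrier drawn from `ν`, the configuration after every sweep of `(-N, N]` has law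
exactly `μ^ℤ`. By attraction each site is eventually constant in `N`, so the limit `T` has the same
law. -/
theorem isInvariant_of_isAttracting {J K : WithTop ℝ} {μ ν : Measure ℝ} [IsProbabilityMeasure μ]
    [IsProbabilityMeasure ν] (hF : MeasurePreserving (F J K) (μ.prod ν) (μ.prod ν))
    (h : ∀ᵐ x ∂(iidLaw μ), ∃ u, IsViableCarrier J K x u ∧ IsAttracting J K x u) :
    IsInvariant J K μ := by
  classical
  let T : (ℤ → ℝ) → ℤ → ℝ := fun x =>
    if hx : ∃ u, IsViableCarrier J K x u ∧ IsAttracting J K x u then output J K x hx.choose else 0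
  have hT : ∀ᵐ x ∂(iidLaw μ), ∃ u, IsViableCarrier J K x u ∧ IsAttracting J K x u ∧
      T x = output J K x u := by
    filter_upwards [h] with x hx
    exact ⟨hx.choose, hx.choose_spec.1, hx.choose_spec.2, dif_pos hx⟩
  have hlim : ∀ᵐ x ∂(iidLaw μ), ∀ (U : ℝ) (k : ℤ),
      ∀ᶠ N : ℕ in atTop, (sweep J K (-N) (2 * N) (x, U)).1 k = T x k := by
    filter_upwards [hT] with x hx U k
    obtain ⟨u, -, hu, hTx⟩ := hx
    rw [hTx]
    exact hu.eventually_sweep U k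
  have hm : AEMeasurable T (iidLaw μ) := by
    -- `T` involves a choice of carrier; its measurability comes from being an almost sure limit of
    -- sweeps with the fixed starting value `0`.
    refine aemeasurable_of_tendsto_metrizable_ae atTop
      (f := fun (N : ℕ) x => (sweep J K (-N) (2 * N) (x, 0)).1) (fun N => ?_) ?_
    · exact ((measurable_sweep J K _ _).comp measurable_prodMk_right).fst.aemeasurable
    · filter_upwards [hlim] with x hx
      rw [tendsto_pi_nhds]
      exact fun k => tendsto_const_nhds.congr' ((hx 0 k).mono fun N hN => hN.symm)
  refine isInvariant_of_isStep (T := T) ?_ hm ?_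
  · filter_upwards [hT] with x hx
    obtain ⟨u, hu, -, hTx⟩ := hx
    exact ⟨u, hu, hTx⟩
  rw [Measure.map_congr hm.ae_eq_mk]
  conv_rhs => rw [iidLaw]
  refine Measure.eq_infinitePi _ fun s t ht => ?_
  have hbox : MeasurableSet (Set.pi (s : Set ℤ) t) := .pi s.countable_toSet fun i _ => ht i
  have hmk := hm.measurable_mk
  rw [Measure.map_apply hmk hbox]
  have hsw : ∀ N : ℕ, ((iidLaw μ).prod ν)
      ((fun p => (sweep J K (-N) (2 * N) p).1) ⁻¹' Set.pi (s : Set ℤ) t) =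
        ∏ i ∈ s, μ (t i) := by
    intro N
    have h1 := measurePreserving_fst.comp (measurePreserving_sweep hF (-N) (2 * N))
    rw [show (fun p => (sweep J K (-N) (2 * N) p).1) = Prod.fst ∘ sweep J K (-N) (2 * N) from rfl,
      h1.measure_preimage hbox.nullMeasurableSet, iidLaw,
      Measure.infinitePi_pi _ (fun i _ => ht i)]
  -- The finitely many coordinates of the box eventually stop changing, so its indicators converge
  -- for arbitrary measurable sides, with no condition on boundaries.
  have htend := tendsto_measure_of_ae_tendsto_indicator_of_isFiniteMeasure
    (μ := (iidLaw μ).prod ν) atTop (A := (fun p => hm.mk T p.1) ⁻¹' Set.pi (s : Set ℤ) t)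
    (As := fun N : ℕ => (fun p => (sweep J K (-N) (2 * N) p).1) ⁻¹' Set.pi (s : Set ℤ) t)
    ((hmk.comp measurable_fst) hbox) (fun N => (measurable_sweep J K _ _).fst hbox) ?_
  · simp only [hsw] at htend
    rw [tendsto_nhds_unique tendsto_const_nhds htend,
      show (fun p : (ℤ → ℝ) × ℝ => hm.mk T p.1) = hm.mk T ∘ Prod.fst from rfl, Set.preimage_comp,
      measurePreserving_fst.measure_preimage (hmk hbox).nullMeasurableSet]
  · have h1 : ∀ᵐ p ∂((iidLaw μ).prod ν), T p.1 = hm.mk T p.1 ∧ ∀ (U : ℝ) (k : ℤ),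
        ∀ᶠ N : ℕ in atTop, (sweep J K (-N) (2 * N) (p.1, U)).1 k = T p.1 k :=
      measurePreserving_fst.quasiMeasurePreserving.ae (hm.ae_eq_mk.and hlim)
    filter_upwards [h1] with p hp
    have h2 : ∀ᶠ N : ℕ in atTop, ∀ k ∈ s, (sweep J K (-N) (2 * N) p).1 k = hm.mk T p.1 k := by
      rw [Filter.eventually_all_finset]
      intro k _
      rw [← hp.1]
      exact hp.2 p.2 k
    filter_upwards [h2] with N hN
    simp only [Set.mem_preimage, Set.mem_pi, Finset.mem_coe]
    exact forall₂_congr fun k hk => by rw [hN k hk]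

/-! ### Renewal: long runs and local determination of the carrier -/

/-- A set of positive measure is visited infinitely often to the left by arbitrarily long runs. -/
theorem ae_exists_run {μ : Measure ℝ} [IsProbabilityMeasure μ] {A : Set ℝ} (hA : MeasurableSet A)
    (h0 : μ A ≠ 0) (L : ℕ) :
    ∀ᵐ x ∂(iidLaw μ), ∀ n : ℤ, ∃ k ≤ n, ∀ i : ℕ, i < L → x (k - i) ∈ A := by
  rcases Nat.eq_zero_or_pos L with rfl | hL
  · exact Eventually.of_forall fun x n => ⟨n, le_rfl, by simp⟩
  -- Disjoint blocks of length `L` going to the left are independent and equally likely to lie in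
  -- `A`, which is the setting of the second Borel–Cantelli lemma.
  let B : ℕ → Finset ℤ := fun j => (Finset.range L).image (fun i : ℕ => -(j * L : ℤ) - i)
  let E : ℕ → Set (ℤ → ℝ) := fun j => Set.pi (B j) (fun _ => A)
  have hEm : ∀ j, MeasurableSet (E j) := fun j => .pi (B j).countable_toSet fun _ _ => hA
  have hpi : ∀ s : Finset ℤ, iidLaw μ (Set.pi s (fun _ => A)) = ∏ _i ∈ s, μ A := fun s =>
    Measure.infinitePi_pi _ (fun _ _ => hA)
  have hdisj : ∀ j j', j ≠ j' → Disjoint (B j) (B j') := by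
    intro j j' hj
    rw [Finset.disjoint_left]
    intro k hk hk'
    simp only [B, Finset.mem_image, Finset.mem_range] at hk hk'
    obtain ⟨i, hi, rfl⟩ := hk
    obtain ⟨i', hi', h⟩ := hk'
    have h1 : (j * L + i : ℤ) = j' * L + i' := by linarith
    have h2 : j * L + i = j' * L + i' := by exact_mod_cast h1
    have h3 : (j * L + i) / L = (j' * L + i') / L := by rw [h2]
    rw [mul_comm j, mul_comm j', Nat.mul_add_div hL, Nat.mul_add_div hL, Nat.div_eq_of_lt hi,
      Nat.div_eq_of_lt hi'] at h3
    exact hj (by omega)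
  have hind : ProbabilityTheory.iIndepSet E (iidLaw μ) := by
    rw [ProbabilityTheory.iIndepSet_iff_meas_biInter hEm]
    intro s
    have h1 : ⋂ j ∈ s, E j = Set.pi (s.biUnion B) (fun _ => A) := by
      ext x
      simp only [E, Set.mem_iInter, Set.mem_pi, Finset.mem_coe, Finset.mem_biUnion]
      exact ⟨fun h k ⟨j, hj, hk⟩ => h j hj k hk, fun h j hj k hk => h k ⟨j, hj, hk⟩⟩
    rw [h1, hpi, Finset.prod_biUnion fun j _ j' _ h => hdisj j j' h]
    exact Finset.prod_congr rfl fun j _ => (hpi _).symm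
  have hsum : ∑' j, iidLaw μ (E j) = ⊤ := by
    have h1 : ∀ j, iidLaw μ (E j) = μ A ^ L := by
      intro j
      rw [hpi, Finset.prod_const, Finset.card_image_of_injective _ (fun a b h => by simpa using h),
        Finset.card_range]
    simp only [h1]
    exact ENNReal.tsum_const_eq_top_of_ne_zero (pow_ne_zero _ h0)
  have hone := ProbabilityTheory.measure_limsup_eq_one hEm hind hsum
  have hae := (mem_ae_iff_prob_eq_one (MeasurableSet.measurableSet_limsup hEm)).2 hone
  filter_upwards [hae] with x hx n
  rw [mem_limsup_iff_frequently_mem] at hx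
  obtain ⟨j, hj, hxj⟩ := hx.forall_exists_of_atTop n.natAbs
  refine ⟨-(j * L : ℤ), ?_, fun i hi => hxj _ ?_⟩
  · have : (j : ℤ) ≤ j * L := le_mul_of_one_le_right (by omega) (by omega)
    omega
  · simp only [B, Finset.coe_image, Finset.coe_range]
    exact ⟨i, hi, rfl⟩

theorem IsCarrier.isCarrierFrom {J K : WithTop ℝ} {x u : ℤ → ℝ} (h : IsCarrier J K x u) (m : ℤ) :
    IsCarrierFrom J K x m u := fun k _ => h k

theorem IsCarrierFrom.mono {J K : WithTop ℝ} {x v : ℤ → ℝ} {m m' : ℤ}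
    (h : IsCarrierFrom J K x m v) (hm : m ≤ m') : IsCarrierFrom J K x m' v :=
  fun k hk => h k (hm.trans_lt hk)

theorem IsCarrierFrom.eq_of_eq {J K : WithTop ℝ} {x v v' : ℤ → ℝ} {m : ℤ}
    (h : IsCarrierFrom J K x m v) (h' : IsCarrierFrom J K x m v') (hm : v m = v' m) {n : ℤ}
    (hn : m ≤ n) : v n = v' n := by
  induction n, hn using Int.leInduction with
  | base => exact hm
  | succ n hn ih =>
    rw [← h (n + 1) (by omega), ← h' (n + 1) (by omega), add_sub_cancel_right, ih]

/-- If arbitrarily far to the left there are sites where the carrier is determined by the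
configuration nearby, then there is a unique carrier. -/
theorem exists_unique_carrier_of_renewal {J K : WithTop ℝ} {x : ℤ → ℝ}
    (h : ∀ n : ℤ, ∃ k ≤ n, ∃ a, ∀ᶠ m in atBot, ∀ v, IsCarrierFrom J K x m v → v k = a) :
    ∃ u, IsAttracting J K x u ∧ IsCarrier J K x u ∧ ∀ u', IsCarrier J K x u' → u' = u := by
  have h1 : ∀ n : ℤ, ∃ b, ∀ᶠ m in atBot, ∀ v, IsCarrierFrom J K x m v → v n = b := by
    intro n
    obtain ⟨k, hk, a, ha⟩ := h n
    refine ⟨carrierFrom J K x k a n, ?_⟩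
    filter_upwards [ha, eventually_le_atBot k] with m hm hmk v hv
    exact (hv.mono hmk).eq_of_eq (isCarrierFrom_carrierFrom J K x k a)
      ((hm v hv).trans (carrierFrom_self ..).symm) hk
  choose u hu using h1
  have hatt : IsAttracting J K x u := fun U n => (hu n).mono fun m hm v _ hv => hm v hv
  refine ⟨u, hatt, hatt.isCarrier, fun u' hu' => funext fun n => ?_⟩
  obtain ⟨m, hm⟩ := (hu n).exists
  exact hm u' (hu'.isCarrierFrom m)

theorem F_snd_coe (j k a b : ℝ) :
    (F (j : WithTop ℝ) (k : WithTop ℝ) (a, b)).2 = a - max (a + b - k) 0 + max (a + b - j) 0 := rfl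

theorem F_snd_top_right (j a b : ℝ) :
    (F (j : WithTop ℝ) ⊤ (a, b)).2 = a + max (a + b - j) 0 := by
  simp [F]

theorem F_fst_top_right (j a b : ℝ) :
    (F (j : WithTop ℝ) ⊤ (a, b)).1 = b - max (a + b - j) 0 := by
  simp [F]

theorem excess_eq_zero {J : WithTop ℝ} {s : ℝ} (h : (s : WithTop ℝ) ≤ J) : excess J s = 0 := by
  induction J using WithTop.recTopCoe with
  | top => rfl
  | coe j =>
    have : s ≤ j := by exact_mod_cast h
    simpa using this

theorem excess_nonneg (J : WithTop ℝ) (s : ℝ) : 0 ≤ excess J s := by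
  induction J using WithTop.recTopCoe with
  | top => exact le_rfl
  | coe j => exact le_max_right _ _

theorem excess_anti {J K : WithTop ℝ} (h : J ≤ K) (s : ℝ) : excess K s ≤ excess J s := by
  induction K using WithTop.recTopCoe with
  | top => exact excess_nonneg J s
  | coe k =>
    lift J to ℝ using ne_top_of_le_ne_top WithTop.coe_ne_top h
    have h' : J ≤ k := by exact_mod_cast h
    simp only [excess_coe]
    gcongr

theorem le_F_snd {J K : WithTop ℝ} (h : J ≤ K) (a b : ℝ) : a ≤ (F J K (a, b)).2 := by
  have := excess_anti h (a + b)
  simp only [F]; linarith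

theorem F_snd_le {J K : WithTop ℝ} (h : K ≤ J) (a b : ℝ) : (F J K (a, b)).2 ≤ a := by
  have := excess_anti h (a + b)
  simp only [F]; linarith

theorem F_eq_swap {J K : WithTop ℝ} {a b : ℝ} (hJ : ((a + b : ℝ) : WithTop ℝ) ≤ J)
    (hK : ((a + b : ℝ) : WithTop ℝ) ≤ K) : F J K (a, b) = (b, a) := by
  simp [F, excess_eq_zero hJ, excess_eq_zero hK]

/-- For `K ≤ J` the carrier leaves a site with at most the value of that site, so `x k + v (k - 1)`
stays below both capacities and `F` just swaps. -/
theorem IsCarrierFrom.eq_of_add_le {J K : WithTop ℝ} (hKJ : K ≤ J) {x v : ℤ → ℝ} {m k : ℤ}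
    (hm : m + 1 < k) (hx : ((x k + x (k - 1) : ℝ) : WithTop ℝ) ≤ K)
    (h : IsCarrierFrom J K x m v) : v k = x k := by
  have h1 : v (k - 1) ≤ x (k - 1) := by
    rw [← h (k - 1) (by omega)]
    exact F_snd_le hKJ _ _
  have h2 : ((x k + v (k - 1) : ℝ) : WithTop ℝ) ≤ K :=
    le_trans (WithTop.coe_le_coe.2 (by linarith)) hx
  rw [← h k (by omega), F_eq_swap (h2.trans hKJ) h2]

/-- A carrier leaves a site with at least its value minus `j - k`. Two values of at least `j - k /
2` then give a sum of at least `j`, so both excess terms are active. -/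
theorem IsCarrierFrom.eq_of_forall_ge {j k : ℝ} (hkj : k ≤ j) {x v : ℤ → ℝ} {m n : ℤ}
    (hm : m + 1 < n) (hx : ∀ i, j - k / 2 ≤ x i)
    (h : IsCarrierFrom (j : WithTop ℝ) (k : WithTop ℝ) x m v) : v n = x n + (k - j) := by
  have h1 := h (n - 1) (by omega)
  have h2 := h n (by omega)
  rw [F_snd_coe] at h1 h2
  have hx1 := hx n
  have hx2 := hx (n - 1)
  grind

/-- The load `v - x` of the carrier decreases along a run of small values of `x`. -/
theorem IsCarrierFrom.eq_of_run_le {j k ε : ℝ} (hjk : j ≤ k) (hε : 0 < ε) {L : ℕ}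
    (hL : k - j ≤ 2 * ε * L) {x v : ℤ → ℝ} {m n : ℤ} (hm : m < n - L)
    (hx : ∀ i : ℕ, i < L + 1 → x (n - i) ≤ j / 2 - ε)
    (h : IsCarrierFrom (j : WithTop ℝ) (k : WithTop ℝ) x m v) : v n = x n := by
  -- The load is `x + v - j` clipped to `[0, k - j]`, hence at most `k - j` at the start; two
  -- neighbouring values below `j / 2 - ε` lower it by at least `2 ε` per site until it vanishes.
  have key : ∀ r : ℕ, r ≤ L → v (n - L + r) - x (n - L + r) ≤ max (k - j - 2 * ε * r) 0 := by
    intro r hr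
    induction r with
    | zero =>
      have h1 := h (n - L) hm
      rw [F_snd_coe] at h1
      simp only [Nat.cast_zero, add_zero, mul_zero, sub_zero]
      grind
    | succ r ih =>
      have h0 := ih (by omega)
      have h1 := h (n - L + (r + 1 : ℕ)) (by push_cast; omega)
      have h2 := hx (L - r) (by omega)
      have h3 := hx (L - (r + 1)) (by omega)
      rw [show n - ((L - r : ℕ) : ℤ) = n - L + r by omega] at h2
      rw [show n - ((L - (r + 1) : ℕ) : ℤ) = n - L + (r + 1 : ℕ) by omega] at h3
      rw [show n - L + (r + 1 : ℕ) - 1 = n - L + (r : ℤ) by push_cast; ring, F_snd_coe] at h1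
      rw [← h1]
      push_cast at h3 ⊢
      have h4 : 2 * ε * (r + 1 : ℝ) = 2 * ε * r + 2 * ε := by ring
      rw [h4]
      grind
  have h1 := key L le_rfl
  rw [sub_add_cancel, max_eq_right (by linarith)] at h1
  have h2 : x n ≤ v n := by
    rw [← h n (by omega)]
    exact le_F_snd (WithTop.coe_le_coe.2 hjk) _ _
  linarith

/-- Along large values the load gains at least `2 ε` per site until it saturates at `k - j`. -/
theorem IsCarrierFrom.eq_of_run_ge {j k ε : ℝ} (hjk : j ≤ k) (hε : 0 < ε) {L : ℕ}
    (hL : k - j ≤ 2 * ε * L) {x v : ℤ → ℝ} {m n : ℤ} (hm : m < n - L)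
    (hx : ∀ i : ℕ, i < L + 1 → j / 2 + ε ≤ x (n - i))
    (h : IsCarrierFrom (j : WithTop ℝ) (k : WithTop ℝ) x m v) : v n = x n + (k - j) := by
  have key : ∀ r : ℕ, r ≤ L → min (2 * ε * r) (k - j) ≤ v (n - L + r) - x (n - L + r) := by
    intro r hr
    induction r with
    | zero =>
      have h1 := h (n - L) hm
      rw [F_snd_coe] at h1
      simp only [Nat.cast_zero, add_zero, mul_zero]
      grind
    | succ r ih =>
      have h0 := ih (by omega)
      have h1 := h (n - L + (r + 1 : ℕ)) (by push_cast; omega)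
      have h2 := hx (L - r) (by omega)
      have h3 := hx (L - (r + 1)) (by omega)
      rw [show n - ((L - r : ℕ) : ℤ) = n - L + r by omega] at h2
      rw [show n - ((L - (r + 1) : ℕ) : ℤ) = n - L + (r + 1 : ℕ) by omega] at h3
      rw [show n - L + (r + 1 : ℕ) - 1 = n - L + (r : ℤ) by push_cast; ring, F_snd_coe] at h1
      rw [← h1]
      push_cast at h3 ⊢
      have h4 : 2 * ε * (r + 1 : ℝ) = 2 * ε * r + 2 * ε := by ring
      rw [h4]
      grind
  have h1 := key L le_rfl
  rw [sub_add_cancel, min_eq_right (by linarith)] at h1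
  have h2 := h n (by omega)
  rw [F_snd_coe] at h2
  grind

theorem isCarrier_self_of_add_le {J K : WithTop ℝ} {x : ℤ → ℝ}
    (hJ : ∀ n, ((x n + x (n - 1) : ℝ) : WithTop ℝ) ≤ J)
    (hK : ∀ n, ((x n + x (n - 1) : ℝ) : WithTop ℝ) ≤ K) :
    IsCarrier J K x x ∧ output J K x x = shift x :=
  ⟨fun n => by rw [F_eq_swap (hJ n) (hK n)],
    funext fun n => by rw [output, F_eq_swap (hJ n) (hK n), shift]⟩

/-- The carrier is permanently full: every sum exceeds both capacities, the load stays at `k - j`,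
and the rest is exchanged as in a swap. -/
theorem isCarrier_add_const {j k : ℝ} {x : ℤ → ℝ} (hj : ∀ n, 2 * j ≤ x n + x (n - 1) + k)
    (hk : ∀ n, j ≤ x n + x (n - 1)) :
    IsCarrier (j : WithTop ℝ) (k : WithTop ℝ) x (fun n => x n + (k - j)) ∧
      output (j : WithTop ℝ) (k : WithTop ℝ) x (fun n => x n + (k - j)) = shift x := by
  have h : ∀ n, F (j : WithTop ℝ) (k : WithTop ℝ) (x n, x (n - 1) + (k - j)) =
      (x (n - 1), x n + (k - j)) := by
    intro n
    have h1 := hj n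
    have h2 := hk n
    simp only [F, excess_coe]
    rw [max_eq_left (by linarith), max_eq_left (by linarith)]
    ext <;> ring
  exact ⟨fun n => by simp only [h], funext fun n => by simp only [output, h, shift]⟩

/-! ### Infinite `K`: the carrier as a running maximum -/

/-- The carrier for `K = ∞` when the potential `D` of `x - j / 2` tends to infinity at `-∞`. -/
theorem exists_viable_carrier_of_potential {j : ℝ} {x D : ℤ → ℝ}
    (hD : ∀ n, D n - D (n - 1) = x n - j / 2) (hlim : Tendsto D atBot atTop) :
    ∃ u, IsViableCarrier (j : WithTop ℝ) ⊤ x u ∧ IsAttracting (j : WithTop ℝ) ⊤ x u := by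
  have hlim' : Tendsto (fun n => D (n - 1)) atBot atTop :=
    hlim.comp (tendsto_atBot_add_const_right _ (-1) tendsto_id)
  have hb : Tendsto (fun n => x n - 2 * D n) atBot atBot := by
    have h1 : Tendsto (fun n => -(D n + D (n - 1)) + j / 2) atBot atBot :=
      tendsto_atBot_add_const_right _ _
        (tendsto_neg_atTop_atBot.comp (hlim.atTop_add_atTop hlim'))
    exact h1.congr fun n => by have := hD n; linarith
  -- After subtracting `2 D` the carrier recursion becomes that of a running maximum of `x - 2 D`.
  have hrec : ∀ {v : ℤ → ℝ} {m : ℤ}, IsCarrierFrom (j : WithTop ℝ) ⊤ x m v → ∀ k, m < k →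
      v k - 2 * D k = max (v (k - 1) - 2 * D (k - 1)) (x k - 2 * D k) := by
    intro v m hv k hk
    have h1 := hv k hk
    rw [F_snd_top_right] at h1
    have h2 := hD k
    grind
  have hmono : ∀ {v : ℤ → ℝ} {m : ℤ}, IsCarrierFrom (j : WithTop ℝ) ⊤ x m v → ∀ k l, m ≤ k →
      k ≤ l → v k - 2 * D k ≤ v l - 2 * D l := by
    intro v m hv k l hk hl
    induction l, hl using Int.leInduction with
    | base => exact le_rfl
    | succ l hl ih =>
      have h1 := hrec hv (l + 1) (by omega)
      rw [add_sub_cancel_right] at h1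
      rw [h1]
      exact ih.trans (le_max_left _ _)
  -- Since `x - 2 D` tends to `-∞` on the left, its supremum over `k ≤ n` is attained; the resulting
  -- `B n` gives the carrier `2 D + B`.
  have hmax : ∀ n : ℤ, ∃ i ≤ n, ∀ k ≤ n, x k - 2 * D k ≤ x i - 2 * D i := by
    intro n
    obtain ⟨m, hm, hmn⟩ := ((eventually_forall_le_atBot.2
      (hb.eventually_le_atBot (x n - 2 * D n))).and (eventually_le_atBot n)).exists
    obtain ⟨i, hi, hi'⟩ := (Finset.Icc m n).exists_max_image (fun k => x k - 2 * D k)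
      ⟨n, by simpa using hmn⟩
    rw [Finset.mem_Icc] at hi
    refine ⟨i, hi.2, fun k hk => ?_⟩
    rcases le_total k m with h | h
    · exact (hm k h).trans (hi' n (by simpa using hmn))
    · exact hi' k (by simpa using ⟨h, hk⟩)
  choose i hin hi using hmax
  let B : ℤ → ℝ := fun n => x (i n) - 2 * D (i n)
  have hlow : ∀ {v : ℤ → ℝ} {m : ℤ}, IsCarrierFrom (j : WithTop ℝ) ⊤ x m v → ∀ n, m < i n →
      B n ≤ v n - 2 * D n := by
    intro v m hv n hn
    refine le_trans ?_ (hmono hv (i n) n hn.le (hin n))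
    rw [hrec hv _ hn]
    exact le_max_right _ _
  have hatt : IsAttracting (j : WithTop ℝ) ⊤ x (fun n => 2 * D n + B n) := by
    intro U n
    -- A fixed starting value, placed far to the left, lies below the maximum and is forgotten.
    have h1 : Tendsto (fun m => U - 2 * D m) atBot atBot := by
      simp only [sub_eq_add_neg]
      exact tendsto_atBot_add_const_left _ _
        (tendsto_neg_atTop_atBot.comp (hlim.const_mul_atTop two_pos))
    filter_upwards [h1.eventually_le_atBot (B n), eventually_lt_atBot (i n)] with m hm hmi v hvU hv
    have hup : ∀ k, m ≤ k → k ≤ n → v k - 2 * D k ≤ B n := by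
      intro k hk
      induction k, hk using Int.leInduction with
      | base => rw [hvU]; exact fun _ => hm
      | succ k hk ih =>
        intro hkn
        rw [hrec hv (k + 1) (by omega), add_sub_cancel_right]
        exact max_le (ih (by omega)) (hi n _ hkn)
    have h2 := hup n (hmi.le.trans (hin n)) le_rfl
    have h3 := hlow hv n hmi
    linarith
  refine ⟨_, ⟨hatt.isCarrier, fun u' hu' ⟨w, hw⟩ => funext fun n => ?_⟩, hatt⟩
  -- A carrier above the running maximum at `n` never meets it to the left of `n`, so there its
  -- output is the mirror image `j - x`. The potential of that output falls to `-∞`, which leaves no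
  -- room for a next carrier `w`.
  by_contra hne
  have hgt : B n < u' n - 2 * D n := by
    refine lt_of_le_of_ne (hlow (hu'.isCarrierFrom (i n - 1)) n (by omega)) fun h => hne ?_
    rw [h]; ring
  have hconst : ∀ k ≤ n, u' k - 2 * D k = u' n - 2 * D n := by
    intro k hk
    induction k, hk using Int.leInductionDown with
    | base => rfl
    | pred k hk ih =>
      have h1 := hrec (hu'.isCarrierFrom (k - 1)) k (by omega)
      have h2 := hi n k hk
      have h3 : x k - 2 * D k < u' k - 2 * D k := by rw [ih]; exact h2.trans_lt hgt
      rcases max_choice (u' (k - 1) - 2 * D (k - 1)) (x k - 2 * D k) with h | h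
      · rw [← ih, h1, h]
      · linarith
  have hout : ∀ k ≤ n, output (j : WithTop ℝ) ⊤ x u' k = j - x k := by
    intro k hk
    have h1 := hu' k
    rw [F_snd_top_right] at h1
    rw [output, F_fst_top_right]
    have h2 := hconst k hk
    have h3 := hconst (k - 1) (by omega)
    have h4 := hD k
    linarith
  have hwmono : ∀ k ≤ n, w k + 2 * D k ≤ w n + 2 * D n := by
    intro k hk
    induction k, hk using Int.leInductionDown with
    | base => exact le_rfl
    | pred k hk ih =>
      refine le_trans ?_ ih
      have h1 := hw k
      rw [F_snd_top_right, hout k hk] at h1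
      have h2 := le_max_left (j - x k + w (k - 1) - j) 0
      have h3 := hD k
      linarith
  obtain ⟨k, hk, hkn⟩ := ((hb.eventually_lt_atBot (j - (w n + 2 * D n))).and
    (eventually_le_atBot n)).exists
  have h1 : output (j : WithTop ℝ) ⊤ x u' k ≤ w k := by
    rw [← hw k]
    exact le_F_snd le_top _ _
  rw [hout k hkn] at h1
  have h2 := hwmono k hkn
  linarith

theorem exists_potential {j : ℝ} {x : ℤ → ℝ}
    (h : Tendsto (fun n : ℕ => ∑ i ∈ Finset.range n, (j / 2 - x (-i))) atTop atTop) :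
    ∃ D : ℤ → ℝ, (∀ n, D n - D (n - 1) = x n - j / 2) ∧ Tendsto D atBot atTop := by
  -- Normalized by `D 0 = 0`; the first sum runs over the sites `n + 1, …, 0`.
  let D : ℤ → ℝ := fun n => if n ≤ 0 then ∑ i ∈ Finset.range (-n).toNat, (j / 2 - x (-i))
    else ∑ i ∈ Finset.range n.toNat, (x (i + 1) - j / 2)
  refine ⟨D, fun n => ?_, ?_⟩
  · rcases le_or_gt n 0 with hn | hn
    · have h1 : (-(n - 1)).toNat = (-n).toNat + 1 := by omega
      have h2 : -((-n).toNat : ℤ) = n := by omega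
      simp only [D, if_pos hn, if_pos (show n - 1 ≤ 0 by omega), h1, Finset.sum_range_succ, h2]
      ring
    · obtain ⟨a, rfl⟩ : ∃ a : ℕ, n = a + 1 := ⟨(n - 1).toNat, by omega⟩
      have h1 : ((a : ℤ) + 1).toNat = a + 1 := by omega
      have h2 : D ((a : ℤ) + 1 - 1) = ∑ i ∈ Finset.range a, (x (i + 1) - j / 2) := by
        rw [add_sub_cancel_right]
        rcases Nat.eq_zero_or_pos a with rfl | ha
        · simp [D]
        · simp only [D, if_neg (show ¬ (a : ℤ) ≤ 0 by omega), Int.toNat_natCast]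
      rw [h2]
      simp only [D, if_neg (show ¬ (a : ℤ) + 1 ≤ 0 by omega), h1, Finset.sum_range_succ]
      ring
  · have hnat : Tendsto (fun n : ℤ => (-n).toNat) atBot atTop := by
      refine tendsto_atTop.2 fun b => ?_
      filter_upwards [eventually_le_atBot (-b : ℤ)] with n hn
      omega
    refine (h.comp hnat).congr' ?_
    filter_upwards [eventually_le_atBot 0] with n hn
    simp only [Function.comp, D, if_pos hn]

/-! ### Almost sure existence of carriers -/

theorem ae_iidLaw_forall {μ : Measure ℝ} [IsProbabilityMeasure μ] {p : ℝ → Prop}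
    (h : ∀ᵐ y ∂μ, p y) : ∀ᵐ x ∂(iidLaw μ), ∀ n, p (x n) := by
  rw [ae_all_iff]
  exact fun n =>
    (measurePreserving_eval_infinitePi (fun _ : ℤ => μ) n).quasiMeasurePreserving.ae h

/-- The strong law of large numbers, read to the left. -/
theorem ae_tendsto_sum_of_integral_lt {μ : Measure ℝ} [IsProbabilityMeasure μ] {a : ℝ}
    (hint : Integrable (fun y => y) μ) (hlt : ∫ y, y ∂μ < a) :
    ∀ᵐ x ∂(iidLaw μ),
      Tendsto (fun n : ℕ => ∑ i ∈ Finset.range n, (a - x (-i))) atTop atTop := by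
  let X : ℕ → (ℤ → ℝ) → ℝ := fun i x => a - x (-i)
  have hev := fun n : ℤ => measurePreserving_eval_infinitePi (fun _ : ℤ => μ) n
  have hint' : Integrable (fun y => a - y) μ := (integrable_const a).sub hint
  have hmap : ∀ i, (iidLaw μ).map (X i) = μ.map (fun y => a - y) := by
    intro i
    have h1 : (iidLaw μ).map (fun x => x (-i)) = μ := (hev (-i)).map_eq
    conv_rhs => rw [← h1, Measure.map_map (by fun_prop) (by fun_prop)]
    rfl
  have hX : ∀ i, ProbabilityTheory.IdentDistrib (X i) (X 0) (iidLaw μ) (iidLaw μ) := fun i =>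
    ⟨by fun_prop, by fun_prop, (hmap i).trans (hmap 0).symm⟩
  have hind : ProbabilityTheory.iIndepFun (fun (n : ℤ) (x : ℤ → ℝ) => a - x n) (iidLaw μ) :=
    ProbabilityTheory.iIndepFun_infinitePi (P := fun _ : ℤ => μ) (X := fun _ y => a - y)
      (fun _ => by fun_prop)
  have hslln := ProbabilityTheory.strong_law_ae_real X ?_ ?_ hX
  · have hmean : ∫ x, X 0 x ∂(iidLaw μ) = a - ∫ y, y ∂μ := by
      calc ∫ x, X 0 x ∂(iidLaw μ) = ∫ y, y ∂((iidLaw μ).map (X 0)) :=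
            (integral_map (φ := X 0) (f := fun y => y) (by fun_prop) (by fun_prop)).symm
        _ = ∫ y, (a - y) ∂μ := by rw [hmap 0, integral_map (by fun_prop) (by fun_prop)]
        _ = a - ∫ y, y ∂μ := by rw [integral_sub (integrable_const a) hint]; simp
    rw [hmean] at hslln
    filter_upwards [hslln] with x hx
    have h1 := hx.pos_mul_atTop (sub_pos.2 hlt) tendsto_natCast_atTop_atTop
    refine h1.congr' ?_
    filter_upwards [eventually_gt_atTop 0] with n hn
    have : (n : ℝ) ≠ 0 := by positivity
    exact div_mul_cancel₀ _ this
  · exact (hev 0).integrable_comp_of_integrable hint'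
  · intro i i' hii
    exact hind.indepFun (by simpa using hii)

theorem tendsto_sum_of_frequently_le {ε : ℝ} (hε : 0 < ε) {y : ℕ → ℝ} (h0 : ∀ i, 0 ≤ y i)
    (h : ∃ᶠ i in atTop, ε ≤ y i) :
    Tendsto (fun n => ∑ i ∈ Finset.range n, y i) atTop atTop := by
  rw [← not_summable_iff_tendsto_nat_atTop_of_nonneg h0]
  intro hs
  obtain ⟨i, hi, hi'⟩ := (h.and_eventually (hs.tendsto_atTop_zero.eventually_lt_const hε)).exists
  linarith

theorem eq_dirac_of_ae_eq {μ : Measure ℝ} [IsProbabilityMeasure μ] {a : ℝ}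
    (h : ∀ᵐ y ∂μ, y = a) : μ = Measure.dirac a := by
  calc μ = μ.map id := Measure.map_id.symm
    _ = μ.map (fun _ => a) := Measure.map_congr h
    _ = Measure.dirac a := by simp

/-- With `f` the distance to the endpoint `a` of the support, a law other than the point mass
charges some region at positive distance from `a`; this provides the gap `ε` for the runs. -/
theorem exists_measure_ne_zero {μ : Measure ℝ} [IsProbabilityMeasure μ] {a : ℝ} {f : ℝ → ℝ}
    (hf : ∀ᵐ y ∂μ, 0 ≤ f y) (hfa : ∀ y, f y = 0 → y = a) (hne : μ ≠ Measure.dirac a) :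
    ∃ ε > 0, μ {y | ε ≤ f y} ≠ 0 := by
  by_contra! hcon
  refine hne (eq_dirac_of_ae_eq ?_)
  have h1 : ∀ᵐ y ∂μ, ∀ n : ℕ, ¬ (1 / ((n : ℝ) + 1) ≤ f y) := by
    rw [ae_all_iff]
    intro n
    rw [ae_iff]
    simpa using hcon (1 / ((n : ℝ) + 1)) (by positivity)
  filter_upwards [hf, h1] with y hy hy'
  refine hfa y (le_antisymm (not_lt.1 fun hpos => ?_) hy)
  obtain ⟨n, hn⟩ := exists_nat_one_div_lt hpos
  exact hy' n hn.le

theorem exists_measure_Iic_ne_zero {μ : Measure ℝ} [IsProbabilityMeasure μ] {a : ℝ}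
    (h : ∀ᵐ y ∂μ, y ≤ a) (hne : μ ≠ Measure.dirac a) :
    ∃ ε > 0, μ (Set.Iic (a - ε)) ≠ 0 := by
  obtain ⟨ε, hε, h0⟩ := exists_measure_ne_zero (f := fun y => a - y)
    (h.mono fun y hy => sub_nonneg.2 hy) (fun y hy => by linarith) hne
  refine ⟨ε, hε, ?_⟩
  convert h0 using 2
  ext y
  exact le_sub_comm (a := y)

theorem exists_measure_Ici_ne_zero {μ : Measure ℝ} [IsProbabilityMeasure μ] {a : ℝ}
    (h : ∀ᵐ y ∂μ, a ≤ y) (hne : μ ≠ Measure.dirac a) :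
    ∃ ε > 0, μ (Set.Ici (a + ε)) ≠ 0 := by
  obtain ⟨ε, hε, h0⟩ := exists_measure_ne_zero (f := fun y => y - a)
    (h.mono fun y hy => sub_nonneg.2 hy) (fun y hy => by linarith) hne
  refine ⟨ε, hε, ?_⟩
  convert h0 using 2
  ext y
  simp only [Set.mem_Ici, Set.mem_ofPred_eq, le_sub_iff_add_le, add_comm ε]

theorem SupportedOn.ae_mem {μ : Measure ℝ} {S : Set ℝ} (h : SupportedOn μ S) : ∀ᵐ y ∂μ, y ∈ S := by
  rw [ae_iff]; exact h

/-- An almost surely unique carrier, obtained from local determination of the carrier. -/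
theorem ae_exists_unique_carrier_of_run {J K : WithTop ℝ} {μ : Measure ℝ} [IsProbabilityMeasure μ]
    {A : Set ℝ} (hA : MeasurableSet A) (h0 : μ A ≠ 0) (L : ℕ)
    (h : ∀ (x : ℤ → ℝ) (k : ℤ), (∀ i : ℕ, i < L → x (k - i) ∈ A) →
      ∃ a, ∀ m < k - L, ∀ v, IsCarrierFrom J K x m v → v k = a) :
    ∀ᵐ x ∂(iidLaw μ), ∃ u, IsAttracting J K x u ∧ IsCarrier J K x u ∧
      ∀ u', IsCarrier J K x u' → u' = u := by
  filter_upwards [ae_exists_run hA h0 L] with x hx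
  refine exists_unique_carrier_of_renewal fun n => ?_
  obtain ⟨k, hk, hrun⟩ := hx n
  obtain ⟨a, ha⟩ := h x k hrun
  exact ⟨k, hk, a, (eventually_lt_atBot (k - L)).mono ha⟩

theorem ae_exists_unique_carrier_of_Iic {j k ε : ℝ} (hjk : j ≤ k) (hε : 0 < ε) {μ : Measure ℝ}
    [IsProbabilityMeasure μ] (h0 : μ (Set.Iic (j / 2 - ε)) ≠ 0) :
    ∀ᵐ x ∂(iidLaw μ), ∃ u, IsAttracting (j : WithTop ℝ) (k : WithTop ℝ) x u ∧
      IsCarrier (j : WithTop ℝ) (k : WithTop ℝ) x u ∧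
      ∀ u', IsCarrier (j : WithTop ℝ) (k : WithTop ℝ) x u' → u' = u := by
  obtain ⟨L, hL⟩ := exists_nat_ge ((k - j) / (2 * ε))
  rw [div_le_iff₀' (by positivity)] at hL
  -- Emptying a load of at most `k - j` takes `L` steps, hence `L + 1` consecutive sites.
  refine ae_exists_unique_carrier_of_run measurableSet_Iic h0 (L + 1) fun x n hx => ?_
  exact ⟨x n, fun m hm v hv => hv.eq_of_run_le hjk hε hL (by push_cast at hm; omega) hx⟩

theorem ae_exists_unique_carrier_of_Ici {j k ε : ℝ} (hjk : j ≤ k) (hε : 0 < ε) {μ : Measure ℝ}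
    [IsProbabilityMeasure μ] (h0 : μ (Set.Ici (j / 2 + ε)) ≠ 0) :
    ∀ᵐ x ∂(iidLaw μ), ∃ u, IsAttracting (j : WithTop ℝ) (k : WithTop ℝ) x u ∧
      IsCarrier (j : WithTop ℝ) (k : WithTop ℝ) x u ∧
      ∀ u', IsCarrier (j : WithTop ℝ) (k : WithTop ℝ) x u' → u' = u := by
  obtain ⟨L, hL⟩ := exists_nat_ge ((k - j) / (2 * ε))
  rw [div_le_iff₀' (by positivity)] at hL
  refine ae_exists_unique_carrier_of_run measurableSet_Ici h0 (L + 1) fun x n hx => ?_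
  exact ⟨x n + (k - j), fun m hm v hv => hv.eq_of_run_ge hjk hε hL (by push_cast at hm; omega) hx⟩

theorem ae_exists_unique_carrier_of_Iic_half {J : WithTop ℝ} {k : ℝ} (hkJ : (k : WithTop ℝ) ≤ J)
    {μ : Measure ℝ} [IsProbabilityMeasure μ] (h0 : μ (Set.Iic (k / 2)) ≠ 0) :
    ∀ᵐ x ∂(iidLaw μ), ∃ u, IsAttracting J (k : WithTop ℝ) x u ∧
      IsCarrier J (k : WithTop ℝ) x u ∧ ∀ u', IsCarrier J (k : WithTop ℝ) x u' → u' = u := by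
  refine ae_exists_unique_carrier_of_run measurableSet_Iic h0 2 fun x n hx => ?_
  have h1 := hx 0 (by norm_num)
  have h2 := hx 1 (by norm_num)
  simp only [Nat.cast_zero, sub_zero, Nat.cast_one, Set.mem_Iic] at h1 h2
  exact ⟨x n, fun m hm v hv => hv.eq_of_add_le hkJ (by push_cast at hm; omega)
    (WithTop.coe_le_coe.2 (by linarith))⟩

/-! ### Invariance in each case -/

/-- A unique carrier that shifts the configuration. -/
theorem isStep_shift_of_unique {J K : WithTop ℝ} {x u u' : ℤ → ℝ}
    (hu : ∀ v, IsCarrier J K x v → v = u) (hu' : IsCarrier J K x u')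
    (h : output J K x u' = shift x) : IsStep J K x (shift x) :=
  ⟨u', isViableCarrier_of_unique hu' fun v hv => (hu v hv).trans (hu u' hu').symm, h.symm⟩

/-- The properties of the exponential and geometric families used for the invariance. -/
def IsReversible (J K : WithTop ℝ) (μ : Measure ℝ) [IsProbabilityMeasure μ] : Prop :=
  ∃ c : ℝ, ((2 * c : ℝ) : WithTop ℝ) < J ∧ ((2 * c : ℝ) : WithTop ℝ) < K ∧
    (∀ a, c < a → μ (Set.Iic a) ≠ 0) ∧
    (∃ ν : Measure ℝ, IsProbabilityMeasure ν ∧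
      MeasurePreserving (F J K) (μ.prod ν) (μ.prod ν)) ∧
    ∀ j : ℝ, J = (j : WithTop ℝ) → K = ⊤ → Integrable (fun y => y) μ ∧ ∫ y, y ∂μ < j / 2

theorem isInvariant_of_eq (J : WithTop ℝ) (μ : Measure ℝ) [IsProbabilityMeasure μ] :
    IsInvariant J J μ := by
  have hF : ∀ p, F J J p = (p.2, p.1) := fun p => by simp [F]
  refine isInvariant_of_isStep_shift (Eventually.of_forall fun x => ?_)
  refine ⟨x, isViableCarrier_of_unique (fun n => by rw [hF]) fun u hu => ?_, ?_⟩
  · funext n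
    rw [← hu n, hF]
  · funext n
    rw [output, hF, shift]

/-- For finite `K`, mass near the lower endpoint `c < J / 2` yields the emptying runs; for `K = ∞`
the mean below `J / 2` makes the potential diverge. -/
theorem IsReversible.isInvariant_of_lt {J K : WithTop ℝ} {μ : Measure ℝ} [IsProbabilityMeasure μ]
    (h : IsReversible J K μ) (hJK : J < K) : IsInvariant J K μ := by
  obtain ⟨c, hcJ, -, hc, ⟨ν, hν, hF⟩, hmean⟩ := h
  lift J to ℝ using hJK.ne_top
  refine isInvariant_of_isAttracting hF ?_
  induction K using WithTop.recTopCoe with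
  | top =>
    obtain ⟨hint, hlt⟩ := hmean J rfl rfl
    filter_upwards [ae_tendsto_sum_of_integral_lt hint hlt] with x hx
    obtain ⟨D, hD, hlim⟩ := exists_potential hx
    exact exists_viable_carrier_of_potential hD hlim
  | coe k =>
    have hcJ' : 2 * c < J := by exact_mod_cast hcJ
    -- The threshold `J / 2 - ε` is the midpoint of `c` and `J / 2`, so it exceeds `c`.
    have hε : 0 < (J / 2 - c) / 2 := by linarith
    filter_upwards [ae_exists_unique_carrier_of_Iic (by exact_mod_cast hJK.le) hε
      (hc _ (by linarith))] with x ⟨u, hu, hu', huniq⟩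
    exact ⟨u, isViableCarrier_of_unique hu' huniq, hu⟩

theorem IsReversible.isInvariant_of_gt {J K : WithTop ℝ} {μ : Measure ℝ} [IsProbabilityMeasure μ]
    (h : IsReversible J K μ) (hKJ : K < J) :
    IsInvariant J K μ ∧ ∀ᵐ x ∂(iidLaw μ), x ∈ XUniq J K := by
  obtain ⟨c, -, hcK, hc, ⟨ν, hν, hF⟩, -⟩ := h
  lift K to ℝ using hKJ.ne_top
  have hcK' : 2 * c < K := by exact_mod_cast hcK
  have hae := ae_exists_unique_carrier_of_Iic_half (J := J) hKJ.le (hc (K / 2) (by linarith))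
  constructor
  · refine isInvariant_of_isAttracting hF ?_
    filter_upwards [hae] with x ⟨u, hu, hu', huniq⟩
    exact ⟨u, isViableCarrier_of_unique hu' huniq, hu⟩
  · filter_upwards [hae] with x ⟨u, _, hu', huniq⟩
    exact mem_XUniq_of_unique hu' huniq

theorem isInvariant_of_lt_of_supportedOn_Iic {j : ℝ} {K : WithTop ℝ} {μ : Measure ℝ}
    [IsProbabilityMeasure μ] (hjK : (j : WithTop ℝ) < K) (hμ : SupportedOn μ (Set.Iic (j / 2)))
    (hne : μ ≠ Measure.dirac (j / 2)) : IsInvariant (j : WithTop ℝ) K μ := by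
  obtain ⟨ε, hε, h0⟩ := exists_measure_Iic_ne_zero hμ.ae_mem hne
  have hshift : ∀ x : ℤ → ℝ, (∀ n, x n ≤ j / 2) →
      IsCarrier (j : WithTop ℝ) K x x ∧ output (j : WithTop ℝ) K x x = shift x := by
    intro x hx
    have h1 : ∀ n, ((x n + x (n - 1) : ℝ) : WithTop ℝ) ≤ (j : WithTop ℝ) := fun n =>
      WithTop.coe_le_coe.2 (by linarith [hx n, hx (n - 1)])
    exact isCarrier_self_of_add_le h1 fun n => (h1 n).trans hjK.le
  refine isInvariant_of_isStep_shift ?_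
  induction K using WithTop.recTopCoe with
  | top =>
    filter_upwards [ae_iidLaw_forall hμ.ae_mem, ae_exists_run measurableSet_Iic h0 1]
      with x hx hrun
    have hfreq : ∃ᶠ i : ℕ in atTop, ε ≤ j / 2 - x (-i) := by
      rw [frequently_atTop]
      intro N
      obtain ⟨k, hk, hk'⟩ := hrun (-N)
      refine ⟨(-k).toNat, by omega, ?_⟩
      have h1 := hk' 0 one_pos
      have h2 : -((-k).toNat : ℤ) = k := by omega
      rw [h2]
      simp only [Nat.cast_zero, sub_zero, Set.mem_Iic] at h1
      linarith
    -- No mean is needed: the increments `j / 2 - x` are nonnegative and infinitely often at least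
    -- `ε`. The viable carrier must then be `x`, whose output, its shift, again has itself as a
    -- carrier.
    obtain ⟨D, hD, hlim⟩ := exists_potential
      (tendsto_sum_of_frequently_le hε (fun i => sub_nonneg.2 (hx (-i))) hfreq)
    obtain ⟨u, hu, -⟩ := exists_viable_carrier_of_potential hD hlim
    obtain ⟨h1, h2⟩ := hshift x hx
    have h3 : x = u := hu.2 x h1 ⟨shift x, by rw [h2]; exact (hshift _ fun n => hx (n - 1)).1⟩
    exact ⟨x, h3 ▸ hu, h2.symm⟩
  | coe k =>
    filter_upwards [ae_iidLaw_forall hμ.ae_mem,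
      ae_exists_unique_carrier_of_Iic (by exact_mod_cast hjK.le) hε h0] with x hx hu
    obtain ⟨u, -, -, huniq⟩ := hu
    exact isStep_shift_of_unique huniq (hshift x hx).1 (hshift x hx).2

theorem isInvariant_of_lt_of_supportedOn_Ici {j k : ℝ} {μ : Measure ℝ}
    [IsProbabilityMeasure μ] (hjk : j < k) (hμ : SupportedOn μ (Set.Ici (j / 2)))
    (hne : μ ≠ Measure.dirac (j / 2)) : IsInvariant (j : WithTop ℝ) (k : WithTop ℝ) μ := by
  obtain ⟨ε, hε, h0⟩ := exists_measure_Ici_ne_zero hμ.ae_mem hne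
  refine isInvariant_of_isStep_shift ?_
  filter_upwards [ae_iidLaw_forall hμ.ae_mem,
    ae_exists_unique_carrier_of_Ici hjk.le hε h0] with x hx hu
  obtain ⟨u, -, -, huniq⟩ := hu
  have hx' : ∀ n, j / 2 ≤ x n := hx
  have h1 : ∀ n, j ≤ x n + x (n - 1) := fun n => by linarith [hx' n, hx' (n - 1)]
  obtain ⟨h2, h3⟩ := isCarrier_add_const (k := k) (fun n => by linarith [h1 n]) h1
  exact isStep_shift_of_unique huniq h2 h3

theorem isInvariant_of_gt_of_supportedOn_Iic {J : WithTop ℝ} {k : ℝ} {μ : Measure ℝ}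
    [IsProbabilityMeasure μ] (hkJ : (k : WithTop ℝ) < J) (hμ : SupportedOn μ (Set.Iic (k / 2))) :
    IsInvariant J (k : WithTop ℝ) μ ∧ ∀ᵐ x ∂(iidLaw μ), x ∈ XUniq J (k : WithTop ℝ) := by
  have h0 : μ (Set.Iic (k / 2)) ≠ 0 := by
    rw [(prob_compl_eq_zero_iff measurableSet_Iic).1 hμ]
    exact one_ne_zero
  have hae := ae_exists_unique_carrier_of_Iic_half hkJ.le h0
  constructor
  · refine isInvariant_of_isStep_shift ?_
    filter_upwards [ae_iidLaw_forall hμ.ae_mem, hae] with x hx hu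
    obtain ⟨u, -, -, huniq⟩ := hu
    have hx' : ∀ n, x n ≤ k / 2 := hx
    have h1 : ∀ n, ((x n + x (n - 1) : ℝ) : WithTop ℝ) ≤ (k : WithTop ℝ) := fun n =>
      WithTop.coe_le_coe.2 (by linarith [hx' n, hx' (n - 1)])
    obtain ⟨h2, h3⟩ := isCarrier_self_of_add_le (fun n => (h1 n).trans hkJ.le) h1
    exact isStep_shift_of_unique huniq h2 h3
  · filter_upwards [hae] with x ⟨u, _, hu', huniq⟩
    exact mem_XUniq_of_unique hu' huniq

theorem isInvariant_of_gt_of_supportedOn_Ici {j k : ℝ} {μ : Measure ℝ}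
    [IsProbabilityMeasure μ] (hkj : k < j) (hμ : SupportedOn μ (Set.Ici (j - k / 2))) :
    IsInvariant (j : WithTop ℝ) (k : WithTop ℝ) μ ∧
      ∀ᵐ x ∂(iidLaw μ), x ∈ XUniq (j : WithTop ℝ) (k : WithTop ℝ) := by
  have hae : ∀ᵐ x ∂(iidLaw μ), ∃ u, IsCarrier (j : WithTop ℝ) (k : WithTop ℝ) x u ∧
      output (j : WithTop ℝ) (k : WithTop ℝ) x u = shift x ∧
      ∀ u', IsCarrier (j : WithTop ℝ) (k : WithTop ℝ) x u' → u' = u := by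
    filter_upwards [ae_iidLaw_forall hμ.ae_mem] with x hx
    have hx' : ∀ n, j - k / 2 ≤ x n := hx
    have h1 : ∀ n, 2 * j - k ≤ x n + x (n - 1) := fun n => by linarith [hx' n, hx' (n - 1)]
    obtain ⟨h2, h3⟩ := isCarrier_add_const (j := j) (k := k) (x := x)
      (fun n => by linarith [h1 n]) (fun n => by linarith [h1 n])
    exact ⟨_, h2, h3, fun u' hu' => funext fun n =>
      (hu'.isCarrierFrom (n - 2)).eq_of_forall_ge hkj.le (by omega) hx⟩
  constructor
  · refine isInvariant_of_isStep_shift ?_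
    filter_upwards [hae] with x ⟨u, hu, hout, huniq⟩
    exact isStep_shift_of_unique huniq hu hout
  · filter_upwards [hae] with x ⟨u, hu, _, huniq⟩
    exact mem_XUniq_of_unique hu huniq

/-! ### The exponential family -/

/-- In the coordinates `(s, x)` with `s = x + u`, `F` fixes `s` and reflects `x` about a point
depending on `s`; shears and reflections preserve Lebesgue measure. -/
theorem measurePreserving_F_volume (J K : WithTop ℝ) :
    MeasurePreserving (F J K) ((volume : Measure ℝ).prod volume)
      ((volume : Measure ℝ).prod volume) := by
  have h1 : MeasurePreserving (fun p : ℝ × ℝ => (p.1, p.1 + p.2)) ((volume : Measure ℝ).prod volume)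
      ((volume : Measure ℝ).prod volume) := measurePreserving_prod_add volume volume
  have h2 : MeasurePreserving
      (fun q : ℝ × ℝ => (q.1, (q.1 - excess J q.1 + excess K q.1) - q.2))
      ((volume : Measure ℝ).prod volume) ((volume : Measure ℝ).prod volume) := by
    refine (MeasurePreserving.id (volume : Measure ℝ)).skew_product
      (g := fun s x => (s - excess J s + excess K s) - x) ?_
      (Eventually.of_forall fun s => (Measure.measurePreserving_sub_left volume _).map_eq)
    have hJ := measurable_excess J
    have hK := measurable_excess K
    simp only [Function.uncurry_def]
    fun_prop
  have h3 : MeasurePreserving (fun q : ℝ × ℝ => (q.1, q.2 - q.1))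
      ((volume : Measure ℝ).prod volume) ((volume : Measure ℝ).prod volume) :=
    (MeasurePreserving.id (volume : Measure ℝ)).skew_product (g := fun y s => s - y)
      (by simp only [Function.uncurry_def]; fun_prop)
      (Eventually.of_forall fun y => (measurePreserving_sub_right volume y).map_eq)
  have h4 := h3.comp (Measure.measurePreserving_swap.comp
    (h2.comp (Measure.measurePreserving_swap.comp h1)))
  convert h4 using 1
  funext p
  ext <;> simp only [F, Function.comp, Prod.swap] <;> ring

theorem measurePreserving_withDensity {α : Type*} [MeasurableSpace α] {ρ : Measure α} {f : α → α}
    (hf : MeasurePreserving f ρ ρ) {g : α → ENNReal} (hg : Measurable g) (h : ∀ᵐ x ∂ρ, g (f x) = g x) :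
    MeasurePreserving f (ρ.withDensity g) (ρ.withDensity g) := by
  refine ⟨hf.measurable, Measure.ext fun s hs => ?_⟩
  rw [Measure.map_apply hf.measurable hs, withDensity_apply _ (hf.measurable hs),
    withDensity_apply _ hs, ← hf.setLIntegral_comp_preimage hs hg]
  exact lintegral_congr_ae (ae_restrict_of_ae (h.mono fun x hx => hx.symm))

theorem measurePreserving_F_normalize {J K : WithTop ℝ} {A B : Measure ℝ} [SFinite A] [SFinite B]
    (h : MeasurePreserving (F J K) (A.prod B) (A.prod B)) :
    MeasurePreserving (F J K) ((normalize A).prod (normalize B))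
      ((normalize A).prod (normalize B)) := by
  simp only [normalize, Measure.prod_smul_left, Measure.prod_smul_right]
  exact (h.smul_measure _).smul_measure _

theorem measure_univ_ne_of_normalize {m : Measure ℝ} [h : IsProbabilityMeasure (normalize m)] :
    m Set.univ ≠ 0 ∧ m Set.univ ≠ ⊤ := by
  have h1 := h.measure_univ
  simp only [normalize, Measure.smul_apply, smul_eq_mul] at h1
  constructor <;> intro h2 <;> simp [h2] at h1

theorem normalize_ne_zero {m : Measure ℝ} [IsProbabilityMeasure (normalize m)] {s : Set ℝ}
    (hs : m s ≠ 0) : normalize m s ≠ 0 := by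
  simp [normalize, hs, (measure_univ_ne_of_normalize (m := m)).2]

theorem integral_normalize_lt {m : Measure ℝ} [IsProbabilityMeasure (normalize m)] {a : ℝ}
    (hint : Integrable (fun y => y) m) (h : 0 < ∫ y, (a - y) ∂m) :
    Integrable (fun y => y) (normalize m) ∧ ∫ y, y ∂(normalize m) < a := by
  obtain ⟨h0, h1⟩ := measure_univ_ne_of_normalize (m := m)
  have hint' : Integrable (fun y => y) (normalize m) :=
    hint.smul_measure (ENNReal.inv_ne_top.2 h0)
  refine ⟨hint', ?_⟩
  have h2 : ∫ y, (a - y) ∂(normalize m) = a - ∫ y, y ∂(normalize m) := by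
    rw [integral_sub (integrable_const a) hint']; simp
  have h3 : 0 < ∫ y, (a - y) ∂(normalize m) := by
    rw [normalize, integral_smul_measure, smul_eq_mul]
    exact mul_pos (ENNReal.toReal_pos (ENNReal.inv_ne_zero.2 h1) (ENNReal.inv_ne_top.2 h0)) h
  linarith

@[simp] theorem sub_top (c : ℝ) : sub ⊤ c = ⊤ := rfl

@[simp] theorem sub_coe (j c : ℝ) : sub (j : WithTop ℝ) c = ((j - c : ℝ) : WithTop ℝ) := rfl

theorem lt_sub_of_two_mul_lt {c : ℝ} {J : WithTop ℝ} (h : ((2 * c : ℝ) : WithTop ℝ) < J) :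
    (c : WithTop ℝ) < sub J c := by
  induction J using WithTop.recTopCoe with
  | top => simp
  | coe j =>
    have h' : 2 * c < j := by exact_mod_cast h
    rw [sub_coe]
    exact WithTop.coe_lt_coe.2 (by linarith)

/-- The first output is at least `min u (J - x)`, hence at least `c`. It is at most `J - x` if `K`
is not exceeded, and at most `u + J - K` otherwise; both are at most `J - c`. The second output is
the same with `J` and `K` exchanged. -/
theorem F_mem_rectangle {J K : WithTop ℝ} {c x u : ℝ}
    (hx : c ≤ x ∧ (x : WithTop ℝ) ≤ sub J c) (hu : c ≤ u ∧ (u : WithTop ℝ) ≤ sub K c) :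
    (c ≤ (F J K (x, u)).1 ∧ ((F J K (x, u)).1 : WithTop ℝ) ≤ sub J c) ∧
      c ≤ (F J K (x, u)).2 ∧ ((F J K (x, u)).2 : WithTop ℝ) ≤ sub K c := by
  induction J using WithTop.recTopCoe with
  | top =>
    induction K using WithTop.recTopCoe with
    | top => simp_all [F]
    | coe k =>
      simp only [sub_coe, sub_top, le_top, and_true, WithTop.coe_le_coe, F, excess_top,
        excess_coe] at *
      grind
  | coe j =>
    induction K using WithTop.recTopCoe with
    | top =>
      simp only [sub_coe, sub_top, le_top, and_true, WithTop.coe_le_coe, F, excess_top,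
        excess_coe] at *
      grind
    | coe k =>
      simp only [sub_coe, WithTop.coe_le_coe, F, excess_coe] at *
      grind

theorem measurableSet_interval (c : ℝ) (a : WithTop ℝ) :
    MeasurableSet {x : ℝ | c ≤ x ∧ (x : WithTop ℝ) ≤ a} := by
  induction a using WithTop.recTopCoe with
  | top =>
    simp only [le_top, and_true]
    exact measurableSet_Ici
  | coe b =>
    simp only [WithTop.coe_le_coe]
    exact measurableSet_Icc

/-- The product density depends only on the conserved sum `x + u`, and the rectangle is invariant in
both directions by involutivity. -/
theorem measurePreserving_F_stExp (J K : WithTop ℝ) (lam c : ℝ) :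
    MeasurePreserving (F J K) ((stExp lam c (sub J c)).prod (stExp lam c (sub K c)))
      ((stExp lam c (sub J c)).prod (stExp lam c (sub K c))) := by
  unfold stExp
  apply measurePreserving_F_normalize
  rw [prod_withDensity (by fun_prop) (by fun_prop), Measure.prod_restrict]
  have hpre : F J K ⁻¹' ({x : ℝ | c ≤ x ∧ (x : WithTop ℝ) ≤ sub J c} ×ˢ
      {x : ℝ | c ≤ x ∧ (x : WithTop ℝ) ≤ sub K c}) =
      {x : ℝ | c ≤ x ∧ (x : WithTop ℝ) ≤ sub J c} ×ˢ
      {x : ℝ | c ≤ x ∧ (x : WithTop ℝ) ≤ sub K c} := by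
    ext ⟨x, u⟩
    constructor
    · rintro ⟨h1, h2⟩
      have h3 := F_mem_rectangle h1 h2
      rw [Prod.mk.eta, F_involutive] at h3
      exact h3
    · rintro ⟨h1, h2⟩
      exact F_mem_rectangle h1 h2
  have h1 := (measurePreserving_F_volume J K).restrict_preimage
    ((measurableSet_interval c (sub J c)).prod (measurableSet_interval c (sub K c)))
  rw [hpre] at h1
  refine measurePreserving_withDensity h1 (by fun_prop) (Eventually.of_forall fun p => ?_)
  rw [← ENNReal.ofReal_mul (Real.exp_pos _).le, ← ENNReal.ofReal_mul (Real.exp_pos _).le,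
    ← Real.exp_add, ← Real.exp_add]
  simp only [F]
  ring_nf

/-- Freezing the decreasing weight at the midpoint `j / 2` can only lower the integrand on either
side, and the frozen integral vanishes by symmetry. -/
theorem integral_exp_mul_pos {lam c j : ℝ} (hlam : 0 < lam) (hc : 2 * c < j) :
    0 < ∫ y in Set.Icc c (j - c), Real.exp (-lam * y) * (j / 2 - y) := by
  have hcj : c < j - c := by linarith
  rw [integral_Icc_eq_integral_Ioc, ← intervalIntegral.integral_of_le hcj.le]
  have h1 : ∫ y in c..(j - c), Real.exp (-lam * (j / 2)) * (j / 2 - y) = 0 := by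
    rw [intervalIntegral.integral_const_mul, intervalIntegral.integral_sub (by simp) (by simp)]
    simp only [intervalIntegral.integral_const, integral_id, smul_eq_mul]
    ring
  rw [← h1]
  have hle : ∀ y, Real.exp (-lam * (j / 2)) * (j / 2 - y) ≤ Real.exp (-lam * y) * (j / 2 - y) := by
    intro y
    rcases le_total y (j / 2) with h | h
    · exact mul_le_mul_of_nonneg_right (Real.exp_le_exp.2 (by nlinarith)) (by linarith)
    · exact mul_le_mul_of_nonpos_right (Real.exp_le_exp.2 (by nlinarith)) (by linarith)
  refine intervalIntegral.integral_lt_integral_of_continuousOn_of_le_of_exists_lt hcj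
    (by fun_prop) (by fun_prop) (fun y _ => hle y) ⟨c, ⟨le_rfl, hcj.le⟩, ?_⟩
  exact mul_lt_mul_of_pos_right (Real.exp_lt_exp.2 (by nlinarith)) (by linarith)

theorem IsExpMarginal.isReversible {J K : WithTop ℝ} {μ : Measure ℝ} [IsProbabilityMeasure μ]
    (h : IsExpMarginal J K μ) : IsReversible J K μ := by
  obtain ⟨lam, c, hJ, hK, hlam, rfl⟩ := h
  refine ⟨c, hJ, hK, fun a ha => ?_, ⟨stExp lam c (sub K c), ?_, measurePreserving_F_stExp ..⟩, ?_⟩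
  · unfold stExp
    have : IsProbabilityMeasure (normalize
        ((volume.restrict {x : ℝ | c ≤ x ∧ (x : WithTop ℝ) ≤ sub J c}).withDensity
          (fun x => ENNReal.ofReal (Real.exp (-lam * x))))) := ‹_›
    apply normalize_ne_zero
    rw [Ne, withDensity_apply_eq_zero (by fun_prop)]
    have h1 : {x | ENNReal.ofReal (Real.exp (-lam * x)) ≠ 0} = Set.univ := by
      ext x; simp [Real.exp_pos]
    rw [h1, Set.univ_inter, Measure.restrict_apply measurableSet_Iic]
    obtain ⟨b, hcb, hb⟩ : ∃ b, c < b ∧ (b : WithTop ℝ) ≤ sub J c := by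
      have h2 := lt_sub_of_two_mul_lt hJ
      revert h2
      induction sub J c using WithTop.recTopCoe with
      | top => exact fun _ => ⟨c + 1, by linarith, le_top⟩
      | coe b => exact fun h2 => ⟨b, by exact_mod_cast h2, le_rfl⟩
    have hsub : Set.Icc c (min a b) ⊆
        Set.Iic a ∩ {x : ℝ | c ≤ x ∧ (x : WithTop ℝ) ≤ sub J c} := fun x hx =>
      ⟨hx.2.trans (min_le_left _ _), hx.1,
        (WithTop.coe_le_coe.2 (hx.2.trans (min_le_right _ _))).trans hb⟩
    refine ne_of_gt (lt_of_lt_of_le ?_ (measure_mono hsub))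
    simp [ha, hcb]
  · refine isProbabilityMeasure_stExp (lt_sub_of_two_mul_lt hK) fun h => hlam (Or.inr ?_)
    simpa [sub] using h
  · rintro j rfl hKtop
    have hlam' := hlam (Or.inr hKtop)
    have hc : 2 * c < j := by exact_mod_cast hJ
    have hset : {x : ℝ | c ≤ x ∧ (x : WithTop ℝ) ≤ sub (j : WithTop ℝ) c} = Set.Icc c (j - c) := by
      ext x; simp only [sub_coe, WithTop.coe_le_coe]; rfl
    unfold stExp
    have : IsProbabilityMeasure (normalize
        ((volume.restrict {x : ℝ | c ≤ x ∧ (x : WithTop ℝ) ≤ sub (j : WithTop ℝ) c}).withDensity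
          (fun x => ENNReal.ofReal (Real.exp (-lam * x))))) := ‹_›
    apply integral_normalize_lt
    · rw [integrable_withDensity_iff_integrable_smul' (by fun_prop) (by simp), hset]
      simp only [ENNReal.toReal_ofReal (Real.exp_pos _).le]
      exact Continuous.integrableOn_Icc (by fun_prop)
    · rw [integral_withDensity_eq_integral_toReal_smul (by fun_prop) (by simp), hset]
      simp only [ENNReal.toReal_ofReal (Real.exp_pos _).le, smul_eq_mul]
      exact integral_exp_mul_pos hlam' hc

/-! ### The geometric family -/

/-- The integer version of `excess`. -/
def excessInt (J : WithTop ℤ) (s : ℤ) : ℤ :=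
  WithTop.recTopCoe 0 (fun j : ℤ => max (s - j) 0) J

@[simp] theorem excessInt_top (s : ℤ) : excessInt ⊤ s = 0 := rfl

@[simp] theorem excessInt_coe (j s : ℤ) : excessInt (j : WithTop ℤ) s = max (s - j) 0 := rfl

/-- The lattice map `F` on integers. -/
def FInt (J K : WithTop ℤ) (p : ℤ × ℤ) : ℤ × ℤ :=
  (p.2 - excessInt J (p.1 + p.2) + excessInt K (p.1 + p.2),
   p.1 - excessInt K (p.1 + p.2) + excessInt J (p.1 + p.2))

theorem FInt_involutive (J K : WithTop ℤ) : Function.Involutive (FInt J K) := by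
  intro p
  have h : (FInt J K p).1 + (FInt J K p).2 = p.1 + p.2 := by simp only [FInt]; ring
  ext
  · change (FInt J K p).2 - excessInt J ((FInt J K p).1 + (FInt J K p).2) +
      excessInt K ((FInt J K p).1 + (FInt J K p).2) = p.1
    rw [h]; simp only [FInt]; ring
  · change (FInt J K p).1 - excessInt K ((FInt J K p).1 + (FInt J K p).2) +
      excessInt J ((FInt J K p).1 + (FInt J K p).2) = p.2
    rw [h]; simp only [FInt]; ring

/-- The capacity `m J`. -/
def scale (m : ℝ) (J : WithTop ℤ) : WithTop ℝ := J.map (fun i : ℤ => m * (i : ℝ))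

@[simp] theorem scale_top (m : ℝ) : scale m ⊤ = ⊤ := rfl

@[simp] theorem scale_coe (m : ℝ) (j : ℤ) :
    scale m (j : WithTop ℤ) = ((m * (j : ℝ) : ℝ) : WithTop ℝ) := rfl

theorem excess_scale {m : ℝ} (hm : 0 < m) (J : WithTop ℤ) (s : ℤ) :
    excess (scale m J) (m * s) = m * excessInt J s := by
  induction J using WithTop.recTopCoe with
  | top => simp
  | coe j =>
    simp only [scale_coe, excess_coe, excessInt_coe]
    push_cast
    rw [mul_max_of_nonneg _ _ hm.le, mul_zero, mul_sub]

theorem F_scale {m : ℝ} (hm : 0 < m) (J K : WithTop ℤ) (i i' : ℤ) :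
    F (scale m J) (scale m K) (m * i, m * i') =
      (m * ((FInt J K (i, i')).1 : ℝ), m * ((FInt J K (i, i')).2 : ℝ)) := by
  have h : m * (i : ℝ) + m * i' = m * ((i + i' : ℤ) : ℝ) := by push_cast; ring
  simp only [F, FInt, h, excess_scale hm]
  ext <;> push_cast <;> ring

/-- `a - c` for `a` in `ℤ ∪ {∞}` and `c` an integer. -/
def subInt (a : WithTop ℤ) (c : ℤ) : WithTop ℤ := a.map (fun y => y - c)

@[simp] theorem subInt_top (c : ℤ) : subInt ⊤ c = ⊤ := rfl

@[simp] theorem subInt_coe (j c : ℤ) : subInt (j : WithTop ℤ) c = ((j - c : ℤ) : WithTop ℤ) := rfl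

theorem FInt_mem_rectangle {J K : WithTop ℤ} {M : ℤ} {p : ℤ × ℤ}
    (h1 : M ≤ p.1 ∧ (p.1 : WithTop ℤ) ≤ subInt J M)
    (h2 : M ≤ p.2 ∧ (p.2 : WithTop ℤ) ≤ subInt K M) :
    (M ≤ (FInt J K p).1 ∧ ((FInt J K p).1 : WithTop ℤ) ≤ subInt J M) ∧
      M ≤ (FInt J K p).2 ∧ ((FInt J K p).2 : WithTop ℤ) ≤ subInt K M := by
  induction J using WithTop.recTopCoe <;> induction K using WithTop.recTopCoe <;>
    simp only [subInt_coe, subInt_top, le_top, and_true, WithTop.coe_le_coe, FInt, excessInt_top,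
      excessInt_coe] at * <;> omega

/-- `J` is an even integer or `∞`. -/
def EvenCapacity (J : WithTop ℤ) : Prop := ∀ j : ℤ, J = (j : WithTop ℤ) → Even j

/-- An excess over an even capacity is either `0` or has the parity of the sum. Compared with a
swap, adding the sum to both entries merely exchanges the two parities back. -/
theorem FInt_parity {J K : WithTop ℤ} (hJ : EvenCapacity J) (hK : EvenCapacity K) (p : ℤ × ℤ) :
    ((Even (FInt J K p).1 ↔ Even p.1) ∧ (Even (FInt J K p).2 ↔ Even p.2)) ∨
      ((Even (FInt J K p).1 ↔ Even p.2) ∧ (Even (FInt J K p).2 ↔ Even p.1)) := by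
  induction J using WithTop.recTopCoe with
  | top =>
    induction K using WithTop.recTopCoe with
    | top => simp [FInt]
    | coe k =>
      have h2 := hK k rfl
      simp only [FInt, excessInt_top, excessInt_coe, Int.even_iff] at *
      omega
  | coe j =>
    have h1 := hJ j rfl
    induction K using WithTop.recTopCoe with
    | top =>
      simp only [FInt, excessInt_top, excessInt_coe, Int.even_iff] at *
      omega
    | coe k =>
      have h2 := hK k rfl
      simp only [FInt, excessInt_coe, Int.even_iff] at *
      omega

/-- The weight of the integer `x` under the bipartite geometric distribution. -/
noncomputable def geoWeight (θ κ : ℝ) (x : ℤ) : ℝ := θ ^ x * (if Even x then 1 else κ)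

theorem geoWeight_pos {θ κ : ℝ} (hθ : 0 < θ) (hκ : 0 < κ) (x : ℤ) : 0 < geoWeight θ κ x := by
  have := zpow_pos hθ x
  unfold geoWeight
  split_ifs <;> positivity

/-- The powers of `θ` see only the conserved sum, and the factors `κ` only the unordered pair of
parities. -/
theorem geoWeight_FInt {J K : WithTop ℤ} {θ κ : ℝ} (hθ : 0 < θ)
    (hpar : κ = 1 ∨ (EvenCapacity J ∧ EvenCapacity K)) (p : ℤ × ℤ) :
    geoWeight θ κ (FInt J K p).1 * geoWeight θ κ (FInt J K p).2 =
      geoWeight θ κ p.1 * geoWeight θ κ p.2 := by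
  have h : (FInt J K p).1 + (FInt J K p).2 = p.1 + p.2 := by simp only [FInt]; ring
  have hw : ∀ q : ℤ × ℤ, geoWeight θ κ q.1 * geoWeight θ κ q.2 =
      θ ^ (q.1 + q.2) * ((if Even q.1 then 1 else κ) * (if Even q.2 then 1 else κ)) := by
    intro q
    rw [zpow_add₀ hθ.ne']
    simp only [geoWeight]
    ring
  rw [hw, hw, h]
  congr 1
  rcases hpar with rfl | ⟨hJ, hK⟩
  · simp
  · rcases FInt_parity hJ hK p with ⟨h1, h2⟩ | ⟨h1, h2⟩
    · simp only [h1, h2]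
    · simp only [h1, h2, mul_comm]

/-- The unnormalized bipartite geometric distribution. -/
noncomputable def geoMass (θ : ℝ) (M : ℤ) (N : WithTop ℤ) (κ m : ℝ) : Measure ℝ :=
  Measure.sum (fun x : {x : ℤ // M ≤ x ∧ (x : WithTop ℤ) ≤ N} =>
    ENNReal.ofReal (geoWeight θ κ x) • Measure.dirac (m * ((x : ℤ) : ℝ)))

theorem sstbGeo_eq_normalize (θ : ℝ) (M : ℤ) (N : WithTop ℤ) (κ m : ℝ) :
    sstbGeo θ M N κ m = normalize (geoMass θ M N κ m) := rfl

instance (θ : ℝ) (M : ℤ) (N : WithTop ℤ) (κ m : ℝ) : SFinite (geoMass θ M N κ m) := by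
  unfold geoMass; infer_instance

theorem measurePreserving_F_sstbGeo {m : ℝ} (hm : 0 < m) (J K : WithTop ℤ) (M : ℤ) {θ κ : ℝ}
    (hθ : 0 < θ) (hκ : 0 < κ) (hpar : κ = 1 ∨ (EvenCapacity J ∧ EvenCapacity K)) :
    MeasurePreserving (F (scale m J) (scale m K))
      ((sstbGeo θ M (subInt J M) κ m).prod (sstbGeo θ M (subInt K M) κ m))
      ((sstbGeo θ M (subInt J M) κ m).prod (sstbGeo θ M (subInt K M) κ m)) := by
  simp only [sstbGeo_eq_normalize]
  apply measurePreserving_F_normalize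
  refine ⟨measurable_F _ _, ?_⟩
  simp only [geoMass]
  rw [Measure.prod_sum, Measure.map_sum (measurable_F _ _).aemeasurable]
  let f : ({x : ℤ // M ≤ x ∧ (x : WithTop ℤ) ≤ subInt J M} ×
      {x : ℤ // M ≤ x ∧ (x : WithTop ℤ) ≤ subInt K M}) →
      ({x : ℤ // M ≤ x ∧ (x : WithTop ℤ) ≤ subInt J M} ×
      {x : ℤ // M ≤ x ∧ (x : WithTop ℤ) ≤ subInt K M}) := fun p =>
    (⟨(FInt J K (p.1.1, p.2.1)).1, (FInt_mem_rectangle p.1.2 p.2.2).1⟩,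
      ⟨(FInt J K (p.1.1, p.2.1)).2, (FInt_mem_rectangle p.1.2 p.2.2).2⟩)
  have hf : Function.Involutive f := by
    rintro ⟨⟨i, hi⟩, ⟨i', hi'⟩⟩
    have h1 := FInt_involutive J K (i, i')
    simp only [f, Prod.mk.injEq, Subtype.mk.injEq]
    exact ⟨congrArg Prod.fst h1, congrArg Prod.snd h1⟩
  ext s hs
  -- `F` permutes the atoms of the product; reindexing by this involution matches them one by one,
  -- with equal weights.
  rw [Measure.sum_apply _ hs, Measure.sum_apply _ hs, ← (Equiv.tsum_eq hf.toPerm)]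
  refine tsum_congr fun p => ?_
  congr 1
  have h2 := FInt_involutive J K (p.1.1, p.2.1)
  have hw := geoWeight_FInt (J := J) (K := K) hθ hpar (p.1.1, p.2.1)
  have hpos := fun x => (geoWeight_pos hθ hκ x).le
  have h3 : F (scale m J) (scale m K)
      (m * ((FInt J K (p.1.1, p.2.1)).1 : ℝ), m * ((FInt J K (p.1.1, p.2.1)).2 : ℝ)) =
      (m * (p.1.1 : ℝ), m * (p.2.1 : ℝ)) := by
    rw [F_scale hm, Prod.mk.eta, h2]
  simp only [Measure.prod_smul_left, Measure.prod_smul_right, Measure.map_smul,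
    Measure.dirac_prod_dirac, Measure.map_dirac' (measurable_F _ _), smul_smul,
    Function.Involutive.coe_toPerm, f, h3]
  rw [← ENNReal.ofReal_mul (hpos _), ← ENNReal.ofReal_mul (hpos _), mul_comm, hw, mul_comm]

/-- Pairing each point with its mirror image `j - g i` doubles the sum into products of a weight
difference and a deviation from the centre, which have the same sign. The factor `κ` is common to
the pair because `κ = 1` or `j` is even. -/
theorem sum_geoWeight_mul_pos {ι : Type*} [Fintype ι] (g : ι → ℤ) (σ : Equiv.Perm ι) {j : ℤ}
    (hσ : ∀ i, g (σ i) = j - g i) (i₀ : ι) (hi₀ : 2 * g i₀ < j)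
    {θ κ m : ℝ} (hm : 0 < m) (hθ : 0 < θ) (hθ1 : θ < 1) (hκ : 0 < κ) (hpar : κ = 1 ∨ Even j) :
    0 < ∑ i, geoWeight θ κ (g i) * (m * j / 2 - m * g i) := by
  have hdouble : 2 * ∑ i, geoWeight θ κ (g i) * (m * j / 2 - m * g i) =
      ∑ i, (geoWeight θ κ (g i) - geoWeight θ κ (g (σ i))) * (m * j / 2 - m * g i) := by
    simp only [sub_mul (geoWeight θ κ _)]
    rw [Finset.sum_sub_distrib, two_mul, sub_eq_add_neg, ← Finset.sum_neg_distrib]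
    congr 1
    rw [← Equiv.sum_comp σ]
    refine Finset.sum_congr rfl fun i _ => ?_
    rw [hσ]
    push_cast
    ring
  have hκ' : ∀ i, (if Even (g (σ i)) then 1 else κ) = if Even (g i) then 1 else κ := by
    intro i
    rcases hpar with rfl | hj
    · simp
    · rw [hσ]
      simp [Int.even_sub, hj]
  have hκpos : ∀ i, 0 < if Even (g i) then 1 else κ := by
    intro i
    split_ifs <;> positivity
  have hlt : ∀ i, 2 * g i < j →
      0 < (geoWeight θ κ (g i) - geoWeight θ κ (g (σ i))) * (m * j / 2 - m * g i) := by
    intro i hi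
    have h1 : θ ^ g (σ i) < θ ^ g i := by
      rw [hσ]
      exact zpow_right_strictAnti₀ hθ hθ1 (by omega)
    have h2 : (2 * g i : ℝ) < j := by exact_mod_cast hi
    simp only [geoWeight, hκ']
    refine mul_pos (sub_pos.2 (mul_lt_mul_of_pos_right h1 (hκpos i))) ?_
    nlinarith
  have hge : ∀ i, j ≤ 2 * g i →
      0 ≤ (geoWeight θ κ (g i) - geoWeight θ κ (g (σ i))) * (m * j / 2 - m * g i) := by
    intro i hi
    have h1 : θ ^ g i ≤ θ ^ g (σ i) := by
      rw [hσ]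
      exact (zpow_right_strictAnti₀ hθ hθ1).antitone (by omega)
    have h2 : (j : ℝ) ≤ 2 * g i := by exact_mod_cast hi
    simp only [geoWeight, hκ']
    refine mul_nonneg_of_nonpos_of_nonpos
      (sub_nonpos.2 (mul_le_mul_of_nonneg_right h1 (hκpos i).le)) ?_
    nlinarith
  have hsum := Finset.sum_pos' (s := Finset.univ) (f := fun i =>
    (geoWeight θ κ (g i) - geoWeight θ κ (g (σ i))) * (m * j / 2 - m * g i))
    (fun i _ => (lt_or_ge (2 * g i) j).elim (fun h => (hlt i h).le) (hge i))
    ⟨i₀, Finset.mem_univ _, hlt i₀ hi₀⟩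
  rw [← hdouble] at hsum
  linarith

theorem isReversible_sstbGeo {m : ℝ} (hm : 0 < m) {J K : WithTop ℤ} {M : ℤ} {θ κ : ℝ}
    (hJ : ((2 * M : ℤ) : WithTop ℤ) < J) (hK : ((2 * M : ℤ) : WithTop ℤ) < K)
    (hθ : 0 < θ) (hθ1 : J = ⊤ ∨ K = ⊤ → θ < 1) (hκ : 0 < κ)
    (hpar : κ = 1 ∨ (EvenCapacity J ∧ EvenCapacity K))
    [hμ : IsProbabilityMeasure (sstbGeo θ M (subInt J M) κ m)] :
    IsReversible (scale m J) (scale m K) (sstbGeo θ M (subInt J M) κ m) := by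
  have hscale : ∀ {J : WithTop ℤ}, ((2 * M : ℤ) : WithTop ℤ) < J →
      ((2 * (m * M) : ℝ) : WithTop ℝ) < scale m J := by
    intro J hJ
    induction J using WithTop.recTopCoe with
    | top => exact WithTop.coe_lt_top _
    | coe j =>
      have h1 : 2 * M < j := by exact_mod_cast hJ
      have h2 : (2 * M : ℝ) < j := by exact_mod_cast h1
      rw [scale_coe]
      exact WithTop.coe_lt_coe.2 (by nlinarith)
  have hsub : ∀ {J : WithTop ℤ}, ((2 * M : ℤ) : WithTop ℤ) < J →
      (M : WithTop ℤ) ≤ subInt J M := by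
    intro J hJ
    induction J using WithTop.recTopCoe with
    | top => simp
    | coe j =>
      have h1 : 2 * M < j := by exact_mod_cast hJ
      rw [subInt_coe]
      exact WithTop.coe_le_coe.2 (by omega)
  refine ⟨m * M, hscale hJ, hscale hK, fun a ha => ?_, ⟨_, ?_,
    measurePreserving_F_sstbGeo hm J K M hθ hκ hpar⟩, fun j hj hKtop => ?_⟩
  · rw [sstbGeo_eq_normalize] at hμ ⊢
    apply normalize_ne_zero
    rw [geoMass, Measure.sum_apply _ measurableSet_Iic]
    intro h
    rw [ENNReal.tsum_eq_zero] at h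
    have h1 := h ⟨M, le_rfl, hsub hJ⟩
    rw [Measure.smul_apply, Measure.dirac_apply_of_mem (Set.mem_Iic.2 ha.le)] at h1
    simp only [smul_eq_mul, mul_one, ENNReal.ofReal_eq_zero] at h1
    exact absurd (geoWeight_pos hθ hκ M) (not_lt.2 h1)
  · refine isProbabilityMeasure_sstbGeo hθ hκ (hsub hK) fun h => hθ1 (Or.inr ?_)
    simpa [subInt] using h
  · obtain rfl : K = ⊤ := by simpa [scale] using hKtop
    obtain ⟨j', rfl⟩ : ∃ j' : ℤ, J = (j' : WithTop ℤ) := by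
      induction J using WithTop.recTopCoe with
      | top => simp at hj
      | coe j' => exact ⟨j', rfl⟩
    have hj' : m * (j' : ℝ) = j := WithTop.coe_injective hj
    have h2M : 2 * M < j' := by exact_mod_cast hJ
    have hfin : Finite {x : ℤ // M ≤ x ∧ (x : WithTop ℤ) ≤ subInt (j' : WithTop ℤ) M} := by
      refine Set.Finite.to_subtype ((Set.finite_Icc M (j' - M)).subset ?_)
      rintro x ⟨h1, h2⟩
      exact ⟨h1, WithTop.coe_le_coe.1 h2⟩
    have := Fintype.ofFinite {x : ℤ // M ≤ x ∧ (x : WithTop ℤ) ≤ subInt (j' : WithTop ℤ) M}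
    let f : {x : ℤ // M ≤ x ∧ (x : WithTop ℤ) ≤ subInt (j' : WithTop ℤ) M} →
        {x : ℤ // M ≤ x ∧ (x : WithTop ℤ) ≤ subInt (j' : WithTop ℤ) M} := fun x =>
      ⟨j' - x.1, by
        have h1 : x.1 ≤ j' - M := WithTop.coe_le_coe.1 x.2.2
        have h2 := x.2.1
        exact ⟨by omega, WithTop.coe_le_coe.2 (show j' - x.1 ≤ j' - M by omega)⟩⟩
    have hf : Function.Involutive f := fun x => by
      simp only [f, sub_sub_cancel]
    rw [sstbGeo_eq_normalize] at hμ ⊢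
    have hint : ∀ g : ℝ → ℝ, Integrable g (geoMass θ M (subInt (j' : WithTop ℤ) M) κ m) :=
      fun g => integrable_sum_dirac (fun _ => ENNReal.ofReal_ne_top) (hasSum_fintype _).summable
    apply integral_normalize_lt (hint _)
    have hsum := integral_sum_measure (hint fun y => j / 2 - y)
    rw [tsum_fintype] at hsum
    rw [geoMass, hsum]
    have hpos := sum_geoWeight_mul_pos (fun x => x.1) hf.toPerm (j := j') (fun _ => rfl)
      ⟨M, le_rfl, hsub hJ⟩ h2M hm hθ (hθ1 (Or.inr rfl)) hκ
      (hpar.imp_right fun h => h.1 j' rfl)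
    convert hpos using 2 with x
    rw [integral_smul_measure, integral_dirac, smul_eq_mul,
      ENNReal.toReal_ofReal (geoWeight_pos hθ hκ x.1).le, ← hj']

theorem InLattice.exists_eq_scale {m : ℝ} {a : WithTop ℝ} (h : InLattice m a) :
    ∃ b : WithTop ℤ, a = scale m b := by
  rcases h with rfl | ⟨i, rfl⟩
  · exact ⟨⊤, rfl⟩
  · exact ⟨(i : WithTop ℤ), rfl⟩

theorem evenCapacity_of_inLattice {m : ℝ} (hm : 0 < m) {J : WithTop ℤ} {M : ℤ}
    (h : InLattice (2 * m) (sub (scale m J) (2 * (m * M)))) : EvenCapacity J := by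
  rintro j rfl
  rw [scale_coe, sub_coe] at h
  obtain h | ⟨i, h⟩ := h
  · exact absurd h WithTop.coe_ne_top
  · have h1 : m * (j : ℝ) - 2 * (m * M) = 2 * m * i := by exact_mod_cast h
    have h2 : m * (j : ℝ) = m * ((2 * (M + i) : ℤ) : ℝ) := by push_cast; linarith
    have h3 : j = 2 * (M + i) := by exact_mod_cast mul_left_cancel₀ hm.ne' h2
    exact h3 ▸ even_two_mul _

theorem two_mul_lt_of_scale {m : ℝ} (hm : 0 < m) {J : WithTop ℤ} {M : ℤ}
    (h : ((2 * (m * M) : ℝ) : WithTop ℝ) < scale m J) : ((2 * M : ℤ) : WithTop ℤ) < J := by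
  induction J using WithTop.recTopCoe with
  | top => exact WithTop.coe_lt_top _
  | coe j =>
    rw [scale_coe, WithTop.coe_lt_coe] at h
    have h1 : (2 * M : ℝ) < j := by nlinarith
    exact WithTop.coe_lt_coe.2 (by exact_mod_cast h1)

theorem eq_subInt_of_sub_scale {m : ℝ} (hm : 0 < m) {J N : WithTop ℤ} {M : ℤ}
    (h : sub (scale m J) (m * M) = scale m N) : N = subInt J M := by
  induction J using WithTop.recTopCoe with
  | top =>
    induction N using WithTop.recTopCoe with
    | top => rfl
    | coe n => exact absurd h.symm WithTop.coe_ne_top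
  | coe j =>
    induction N using WithTop.recTopCoe with
    | top => exact absurd h WithTop.coe_ne_top
    | coe n =>
      rw [scale_coe, scale_coe, sub_coe] at h
      have h1 : m * (j : ℝ) - m * M = m * n := by exact_mod_cast h
      have h2 : m * (n : ℝ) = m * ((j - M : ℤ) : ℝ) := by push_cast; linarith
      have h3 : n = j - M := by exact_mod_cast mul_left_cancel₀ hm.ne' h2
      rw [h3, subInt_coe]

/-- The four parameter regimes matter only through two consequences: `θ < 1` when a capacity is
infinite, and even capacities unless `κ = 1`. -/
theorem IsGeoMarginal.isReversible {J K : WithTop ℝ} {μ : Measure ℝ} [IsProbabilityMeasure μ]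
    (h : IsGeoMarginal J K μ) : IsReversible J K μ := by
  obtain ⟨c, m, θ, κ, M, N, hcJ, hcK, hm, -, hJ, hK, hcase, rfl, hN, rfl⟩ := h
  obtain ⟨J, rfl⟩ := hJ.exists_eq_scale
  obtain ⟨K, rfl⟩ := hK.exists_eq_scale
  obtain rfl := eq_subInt_of_sub_scale hm hN
  have htop : ∀ {J : WithTop ℤ}, J = ⊤ → scale m J = ⊤ := by rintro _ rfl; rfl
  have hparam : 0 < θ ∧ (J = ⊤ ∨ K = ⊤ → θ < 1) ∧ 0 < κ ∧
      (κ = 1 ∨ (EvenCapacity J ∧ EvenCapacity K)) := by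
    rcases hcase with ⟨-, -, h1, h2, rfl⟩ | ⟨h3, h4, h1, h2, h5, -⟩ | ⟨h3, h4, -, -, h1, rfl⟩ |
      ⟨h3, h4, h5, h6, h1, h2, -⟩
    · exact ⟨h1, fun _ => h2, one_pos, Or.inl rfl⟩
    · exact ⟨h1, fun _ => h2, h5, Or.inr
        ⟨evenCapacity_of_inLattice hm h3, evenCapacity_of_inLattice hm h4⟩⟩
    · exact ⟨by linarith, fun h => (h.elim (fun h => h3 (htop h)) fun h => h4 (htop h)).elim,
        one_pos, Or.inl rfl⟩
    · exact ⟨by linarith, fun h => (h.elim (fun h => h3 (htop h)) fun h => h4 (htop h)).elim,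
        h2, Or.inr ⟨evenCapacity_of_inLattice hm h5, evenCapacity_of_inLattice hm h6⟩⟩
  obtain ⟨h1, h2, h3, h4⟩ := hparam
  exact isReversible_sstbGeo hm (two_mul_lt_of_scale hm hcJ) (two_mul_lt_of_scale hm hcK)
    h1 h2 h3 h4

end UdKdV

theorem theorem3p6 (J K : WithTop ℝ) (μ : Measure ℝ) [IsProbabilityMeasure μ] :
    (J = K → UdKdV.IsInvariant J K μ) ∧
    (J < K →
      (∀ j : ℝ, J = (j : WithTop ℝ) → μ ≠ Measure.dirac (j / 2)) →
      (UdKdV.IsExpMarginal J K μ ∨ UdKdV.IsGeoMarginal J K μ ∨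
        (∃ j : ℝ, J = (j : WithTop ℝ) ∧ UdKdV.SupportedOn μ (Set.Iic (j / 2))) ∨
        (∃ j : ℝ, J = (j : WithTop ℝ) ∧ K ≠ ⊤ ∧ UdKdV.SupportedOn μ (Set.Ici (j / 2)))) →
      UdKdV.IsInvariant J K μ) ∧
    (K < J →
      (∀ k : ℝ, K = (k : WithTop ℝ) → μ ≠ Measure.dirac (k / 2)) →
      (∀ j k : ℝ, J = (j : WithTop ℝ) → K = (k : WithTop ℝ) →
        μ ≠ Measure.dirac (j - k / 2)) →
      (UdKdV.IsExpMarginal J K μ ∨ UdKdV.IsGeoMarginal J K μ ∨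
        (∃ k : ℝ, K = (k : WithTop ℝ) ∧ UdKdV.SupportedOn μ (Set.Iic (k / 2))) ∨
        (∃ j k : ℝ, J = (j : WithTop ℝ) ∧ K = (k : WithTop ℝ) ∧
          UdKdV.SupportedOn μ (Set.Ici (j - k / 2)))) →
      UdKdV.IsInvariant J K μ ∧ ∀ᵐ x ∂(UdKdV.iidLaw μ), x ∈ UdKdV.XUniq J K) := by
  refine ⟨?_, ?_, ?_⟩
  · rintro rfl
    exact UdKdV.isInvariant_of_eq J μ
  · rintro hJK hne (h | h | ⟨j, rfl, h⟩ | ⟨j, rfl, hK, h⟩)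
    · exact h.isReversible.isInvariant_of_lt hJK
    · exact h.isReversible.isInvariant_of_lt hJK
    · exact UdKdV.isInvariant_of_lt_of_supportedOn_Iic hJK h (hne j rfl)
    · lift K to ℝ using hK
      exact UdKdV.isInvariant_of_lt_of_supportedOn_Ici (by exact_mod_cast hJK) h (hne j rfl)
  · rintro hKJ - - (h | h | ⟨k, rfl, h⟩ | ⟨j, k, rfl, rfl, h⟩)
    · exact h.isReversible.isInvariant_of_gt hKJ
    · exact h.isReversible.isInvariant_of_gt hKJ
    · exact UdKdV.isInvariant_of_gt_of_supportedOn_Iic hKJ h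
    · exact UdKdV.isInvariant_of_gt_of_supportedOn_Ici (by exact_mod_cast hKJ) h
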